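/- Let $d>0$, let $\mathscr D_d=\{z\in\mathbb C:|\Im z|<d\}$ and, for $\epsilon\in(0,1)$, let $\mathscr D_d(\epsilon)=\{z:|\Re z|<1/\epsilon,\ |\Im z|<d(1-\epsilon)\}$. Let $\mathbf B_2(\mathscr D_d)$ be the class of functions $g$ analytic in $\mathscr D_d$ with $\int_{-d}^{d}|g(x+iy)|\,dy\to0$ as $x\to\pm\infty$ and for which the limit $\lim_{\epsilon\to0^+}\big(\int_{\partial\mathscr D_d(\epsilon)}|g(z)|^2\,|dz|\big)^{1/2}$ exists and is finite. For $h>0$ put $S(k,h)(x)=\frac{\sin(\pi(x-kh)/h)}{\pi(x-kh)/h}$ (with value $1$ at $x=kh$), $C_{M,N}(g,h)(x)=\sum_{k=-M}^{N}g(kh)\,S(k,h)(x)$ and $E^{(2)}_{M,N}(g,h)(x)=\frac{d^2}{dx^2}[g(x)]-\frac{d^2}{dx^2}[C_{M,N}(g,h)(x)]$ for $x\in\mathbb R$. Let $W$ be the principal branch of the Lambert W function (the inverse of $w\mapsto we^w$ on $[-1,\infty)$), $x^+=\max\{x,0\}$, and $\|\cdot\|_2$ the norm of $L^2(\mathbb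 R)$. Let $g\in\mathbf B_2(\mathscr D_d)$, and suppose that for some constants $A,\beta_L,\beta_R,\gamma_L,\gamma_R>0$ one has $|g(x)|\le A\exp(-\beta_L\exp(\gamma_L|x|))$ for $x\le0$ and $|g(x)|\le A\exp(-\beta_R\exp(\gamma_R|x|))$ for $x\ge0$. Put $\gamma=\max\{\gamma_L,\gamma_R\}$ and assume $d\le\pi/(2\gamma)$. Let the non-negative integers $M,N,n$ and the number $\beta$ be related by $$\begin{cases} n=M,\ N=\Big\lceil\frac{\gamma_L}{\gamma_R}M\Big(1+\frac{\log(\beta_L/\beta_R)}{W(\pi d\gamma_LM/\beta_L)}\Big)\Big\rceil^+,\ \beta=\beta_L&\text{if }\gamma_L>\gamma_R,\\ n=N,\ M=\Big\lfloor\frac{\gamma_R}{\gamma_L}N\Big(1+\frac{\log(\beta_R/\beta_L)}{W(\pi d\gamma_RN/\beta_R)}\Big)\Big\rfloor^+,\ \beta=\beta_R&\text{if }\gamma_R>\gamma_L,\\ n=M,\ N=\Big\lceil M\Big(1+\frac{\log(\beta_L/\beta_R)}{W(\pi d\gamma_LM/\beta_L)}\Big)\Big\rceil,\ \beta=\beta_L&\text{if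 }\gamma_L=\gamma_R,\ \beta_L\ge\beta_R,\\ n=N,\ M=\Big\lfloor N\Big(1+\frac{\log(\beta_R/\beta_L)}{W(\pi d\gamma_RN/\beta_R)}\Big)\Big\rfloor,\ \beta=\beta_R&\text{if }\gamma_L=\gamma_R,\ \beta_R\ge\beta_L,\end{cases}$$ and let $h=\dfrac{\log(\pi d\gamma n/\beta)}{\gamma n}$. Consider the bound $$\big\|E^{(2)}_{M,N}(g,h)\big\|_2\le K\left(\frac{n}{\log n}\right)^{5/2}\exp\left(-\frac{\pi d\gamma n}{\log(\pi d\gamma n/\beta)}\right).\qquad(*)$$ (i) There is a constant $K>0$, depending only on $g$, $d$ and the decay constants $A,\beta_L,\beta_R,\gamma_L,\gamma_R$ of $g$, such that $(*)$ holds for all such $M,N,n,\beta$ with $n\ge2$ and $\pi d\gamma n>\beta$. (ii) There is a constant $K>0$, depending only on $g$ and $d$, such that for every choice of decay constants $A,\beta_L,\beta_R,\gamma_L,\gamma_R$ as above there is an $n_0$ such that $(*)$ holds for all such $M,N,n,\beta$ with $n\ge n_0$. -/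

import Mathlib

open MeasureTheory Filter Topology

noncomputable section

namespace DESinc

/-- The open strip of width `2d` about the real axis. -/
def strip (d : ℝ) : Set ℂ := {z : ℂ | |z.im| < d}

/-- The integral of `|g|² |dz|` over the boundary of the rectangle
`|Re z| < 1/ε`, `|Im z| < d (1 - ε)`: two horizontal and two vertical sides. -/
def boundaryIntegral (g : ℂ → ℂ) (d ε : ℝ) : ENNReal :=
  (∫⁻ x in Set.Ioo (-(1 / ε)) (1 / ε), ‖g (⟨x, d * (1 - ε)⟩ : ℂ)‖ₑ ^ 2) +
  (∫⁻ x in Set.Ioo (-(1 / ε)) (1 / ε), ‖g (⟨x, -(d * (1 - ε))⟩ : ℂ)‖ₑ ^ 2) +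
  (∫⁻ y in Set.Ioo (-(d * (1 - ε))) (d * (1 - ε)), ‖g (⟨1 / ε, y⟩ : ℂ)‖ₑ ^ 2) +
  (∫⁻ y in Set.Ioo (-(d * (1 - ε))) (d * (1 - ε)), ‖g (⟨-(1 / ε), y⟩ : ℂ)‖ₑ ^ 2)

/-- The class `B₂(D_d)`: analytic functions on the strip whose integral over vertical
cross-sections tends to `0` at both ends and whose boundary `L²` norm
`lim_{ε → 0⁺} (∫_{∂ D_d(ε)} |g|² |dz|)^{1/2}` exists and is finite. -/
structure MemB2 (g : ℂ → ℂ) (d : ℝ) : Prop where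
  analytic : AnalyticOnNhd ℂ g (strip d)
  tendsto_right :
    Tendsto (fun x : ℝ => ∫⁻ y in Set.Ioo (-d) d, ‖g (⟨x, y⟩ : ℂ)‖ₑ) atTop (𝓝 0)
  tendsto_left :
    Tendsto (fun x : ℝ => ∫⁻ y in Set.Ioo (-d) d, ‖g (⟨x, y⟩ : ℂ)‖ₑ) atBot (𝓝 0)
  finite_norm : ∃ L : ENNReal, L < ⊤ ∧
    Tendsto (fun ε : ℝ => (boundaryIntegral g d ε) ^ (1 / 2 : ℝ)) (𝓝[>] 0) (𝓝 L)

/-- The Sinc function `S(k,h)(x) = sin (π (x - k h) / h) / (π (x - k h) / h)`, with value `1`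
at `x = k h` (`Real.sinc` is the unnormalised `sin t / t`). -/
def sincBasis (k : ℤ) (h x : ℝ) : ℝ := Real.sinc (Real.pi * ((x - k * h) / h))

/-- The truncated Sinc expansion `C_{M,N}(g,h)` on the real line. -/
def truncSinc (g : ℂ → ℂ) (M N : ℕ) (h x : ℝ) : ℂ :=
  ∑ k ∈ Finset.Icc (-(M : ℤ)) (N : ℤ), g ((k * h : ℝ) : ℂ) * (sincBasis k h x : ℂ)

/-- The error `E_{M,N}^{(2)}(g,h)` of the second derivative on the real line. -/
def secondDerivError (g : ℂ → ℂ) (M N : ℕ) (h x : ℝ) : ℂ :=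
  iteratedDeriv 2 (fun t : ℝ => g (t : ℂ)) x - iteratedDeriv 2 (truncSinc g M N h) x

/-- The principal branch of the Lambert W function: the inverse of `w ↦ w e^w` on `[-1, ∞)`. -/
def lambertW : ℝ → ℝ := Function.invFunOn (fun w : ℝ => w * Real.exp w) (Set.Ici (-1))

/-- Positive decay constants for which `g` decays double exponentially on the real line, with
left constants `(βL, γL)` and right constants `(βR, γR)`. -/
structure DEDecay (g : ℂ → ℂ) (A βL βR γL γR : ℝ) : Prop where
  A_pos : 0 < A
  βL_pos : 0 < βL
  βR_pos : 0 < βR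
  γL_pos : 0 < γL
  γR_pos : 0 < γR
  left : ∀ x : ℝ, x ≤ 0 → ‖g (x : ℂ)‖ ≤ A * Real.exp (-βL * Real.exp (γL * |x|))
  right : ∀ x : ℝ, 0 ≤ x → ‖g (x : ℂ)‖ ≤ A * Real.exp (-βR * Real.exp (γR * |x|))

/-- The rule that relates the numbers `M`, `N` of Sinc points, and fixes `n` and `β`. -/
def IsChoice (d βL βR γL γR : ℝ) (M N n : ℕ) (β : ℝ) : Prop :=
  (γR < γL ∧ n = M ∧ β = βL ∧
    (N : ℤ) = max ⌈γL / γR * M *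
      (1 + Real.log (βL / βR) / lambertW (Real.pi * d * γL * M / βL))⌉ 0) ∨
  (γL < γR ∧ n = N ∧ β = βR ∧
    (M : ℤ) = max ⌊γR / γL * N *
      (1 + Real.log (βR / βL) / lambertW (Real.pi * d * γR * N / βR))⌋ 0) ∨
  (γL = γR ∧ βR ≤ βL ∧ n = M ∧ β = βL ∧
    (N : ℤ) = ⌈M *
      (1 + Real.log (βL / βR) / lambertW (Real.pi * d * γL * M / βL))⌉) ∨
  (γL = γR ∧ βL ≤ βR ∧ n = N ∧ β = βR ∧
    (M : ℤ) = ⌊N *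
      (1 + Real.log (βR / βL) / lambertW (Real.pi * d * γR * N / βR))⌋)

/-- The mesh size `h = log (π d γ n / β) / (γ n)`. -/
def meshSize (d γ β : ℝ) (n : ℕ) : ℝ := Real.log (Real.pi * d * γ * n / β) / (γ * n)

/-- The convergence rate `(n / log n)^{5/2} exp (-π d γ n / log (π d γ n / β))`. -/
def rate (d γ β : ℝ) (n : ℕ) : ℝ :=
  ((n : ℝ) / Real.log n) ^ (5 / 2 : ℝ) *
    Real.exp (-(Real.pi * d * γ * n / Real.log (Real.pi * d * γ * n / β)))

end DESinc

end

/-! The error splits into a discretization part, from interpolating at all the nodes `k * h`, and a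
truncation part, from the nodes outside `[-M, N]`.

Discretization. On a rectangle whose vertical sides lie midway between nodes, `g` minus its Sinc
interpolant equals `sin (π x / h)` times a Cauchy integral of `g z / sin (π z / h)`
(`sub_truncSinc_eq`). Two derivatives cost at most a factor of order `(1 + 1/h) ^ 2` and raise the
Cauchy kernel to powers up to three. On the horizontal sides the sine is at least `sinh (π b / h)`,
and the powers of the Cauchy kernel are Fourier multipliers bounded on `L²`
(`eLpNorm_cauchy_lower_le`), so these sides are controlled by the boundary norm of `g`. The vertical
sides vanish in the limit by the condition on cross-sections. This gives a bound of order `(1 + 1/h)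
^ 2 / sinh (π d / h)`.

Truncation. Each omitted term is `g (k h)` times the second derivative of a Sinc function, which
lies in `L²`, so the sum of the omitted `|g (k h)|` is what matters
(`exists_eLpNorm_secondDerivError_le`). The mesh makes the decay exponent of `g` at the last node of
the side carrying `n` equal to `π d γ n`; the Lambert W rule makes it at least half of that on the
other side (`exists_forall_half_le`). The tail is then of order `exp (-π d γ n / 4)` up to powers of
`1/h`.

Comparison. Since `1/h` is at most of order `n / log n` and `π d / h` is the exponent of the rate,
the discretization error is of order `(n / log n) ^ 2` times the exponential. The rate has the power
`5/2`: the spare square root tends to infinity and absorbs every constant, while the truncation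
error is exponentially smaller. Hence `K = 1` works for large `n`, which is (ii); for (i), the
finitely many remaining `n` are absorbed in the constant. -/

noncomputable section

namespace DESinc

/-! ### Plancherel for integrable square-integrable functions -/

section

open FourierTransform

/-- Both sides are locally integrable, so testing against smooth compactly supported functions
suffices. The transform can be moved onto the test function on either side: by duality for tempered
distributions on the left, by Fubini on the right. -/
theorem fourier_toLp_ae_eq {f : ℝ → ℂ} (hf : Integrable f) (hf2 : MemLp f 2) :
    (𝓕 (hf2.toLp f) : Lp ℂ 2 (volume : Measure ℝ)) =ᵐ[volume] 𝓕 f := by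
  have hloc1 : LocallyIntegrable (𝓕 (hf2.toLp f) : Lp ℂ 2 (volume : Measure ℝ)) volume :=
    (Lp.memLp _).locallyIntegrable (by norm_num)
  have hcont : Continuous (𝓕 f) := by
    exact VectorFourier.fourierIntegral_continuous Real.continuous_fourierChar
      continuous_inner hf
  refine ae_eq_of_integral_contDiff_smul_eq hloc1 hcont.locallyIntegrable ?_
  intro φ hφ hφc
  let ψ0 : ℝ → ℂ := fun x => (φ x : ℂ)
  have hψ0 : ContDiff ℝ (⊤ : ℕ∞) ψ0 := Complex.ofRealCLM.contDiff.comp hφ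
  have hψc : HasCompactSupport ψ0 := hφc.comp_left (g := fun r : ℝ => (r : ℂ)) rfl
  let ψ : SchwartzMap ℝ ℂ := hψc.toSchwartzMap hψ0
  have hψ : ∀ x, ψ x = (φ x : ℂ) := fun x => rfl
  have key := congrArg (fun D => D ψ) (Lp.fourier_toTemperedDistribution_eq (hf2.toLp f))
  simp only [TemperedDistribution.fourier_apply, Lp.toTemperedDistribution_apply] at key
  have h1 : ∫ x, φ x • (𝓕 (hf2.toLp f) : Lp ℂ 2 (volume : Measure ℝ)) x
      = ∫ x, ψ x • (𝓕 (hf2.toLp f) : Lp ℂ 2 (volume : Measure ℝ)) x := by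
    refine integral_congr_ae (Eventually.of_forall fun x => ?_)
    simp [hψ]
  have h2 : ∫ x, φ x • 𝓕 f x = ∫ x, ψ x • 𝓕 f x := by
    refine integral_congr_ae (Eventually.of_forall fun x => ?_)
    simp [hψ]
  rw [h1, h2, ← key]
  have h3 : ∫ x, (𝓕 ψ) x • (hf2.toLp f) x = ∫ x, (𝓕 ψ) x • f x := by
    refine integral_congr_ae ?_
    filter_upwards [hf2.coeFn_toLp] with x hx
    rw [hx]
  rw [h3, SchwartzMap.fourier_coe]
  have := VectorFourier.integral_fourierIntegral_smul_eq_flip (L := innerₗ ℝ) (μ := volume)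
    (ν := volume) (f := ψ) (g := f) Real.continuous_fourierChar continuous_inner ψ.integrable hf
  rw [flip_innerₗ] at this
  exact this

theorem eLpNorm_fourier_eq {f : ℝ → ℂ} (hf : Integrable f) (hf2 : MemLp f 2) :
    eLpNorm (𝓕 f) 2 volume = eLpNorm f 2 volume := by
  rw [← eLpNorm_congr_ae (fourier_toLp_ae_eq hf hf2), ← eLpNorm_congr_ae hf2.coeFn_toLp,
    ← Lp.enorm_def, ← Lp.enorm_def, enorm_eq_iff_norm_eq, Lp.norm_fourier_eq]

theorem memLp_fourier {f : ℝ → ℂ} (hf : Integrable f) (hf2 : MemLp f 2) :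
    MemLp (𝓕 f) 2 volume :=
  (memLp_congr_ae (fourier_toLp_ae_eq hf hf2)).1 (Lp.memLp _)

end

/-! ### Powers of the Cauchy kernel as Fourier multipliers -/

section

open FourierTransform Set

theorem pow_mul_exp_neg_le {a s : ℝ} (ha : 0 < a) (hs : 0 ≤ s) (m : ℕ) :
    s ^ m * Real.exp (-(a * s)) ≤ m.factorial / a ^ m := by
  have h := Real.pow_div_factorial_le_exp _ (mul_nonneg ha.le hs) m
  rw [Real.exp_neg, ← div_eq_mul_inv, div_le_div_iff₀ (Real.exp_pos _) (by positivity)]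
  rw [div_le_iff₀ (by positivity), mul_pow] at h
  linarith

theorem integrableOn_pow_mul_cexp {w : ℂ} (hw : 0 < w.re) (m : ℕ) :
    IntegrableOn (fun s : ℝ => (s : ℂ) ^ m * Complex.exp (-(w * s))) (Ioi 0) := by
  have hw2 : 0 < w.re / 2 := by positivity
  have h := (integrableOn_exp_mul_Ioi (a := -(w.re / 2)) (by linarith) 0).const_mul
    (m.factorial / (w.re / 2) ^ m)
  refine h.mono' (by fun_prop) ?_
  filter_upwards [ae_restrict_mem measurableSet_Ioi] with s hs
  have hs : 0 < s := hs
  have := pow_mul_exp_neg_le hw2 hs.le m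
  rw [norm_mul, Complex.norm_exp, norm_pow, Complex.norm_real, Real.norm_of_nonneg hs.le]
  have e1 : (-(w * (s : ℂ))).re = -(w.re / 2 * s) + -(w.re / 2) * s := by
    simp; ring
  rw [e1, Real.exp_add, ← mul_assoc]
  gcongr

theorem integral_pow_mul_cexp {w : ℂ} (hw : 0 < w.re) (m : ℕ) :
    ∫ s in Ioi (0 : ℝ), (s : ℂ) ^ m * Complex.exp (-(w * s)) = m.factorial / w ^ (m + 1) := by
  have hw0 : w ≠ 0 := by rintro rfl; simp at hw
  induction m with
  | zero =>
    have := integral_exp_mul_complex_Ioi (a := -w) (by simpa using hw) 0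
    simpa [neg_mul, neg_div] using this
  | succ m ih =>
    have hd : ∀ s ∈ Ici (0 : ℝ), HasDerivAt
        (fun s : ℝ => (s : ℂ) ^ (m + 1) * Complex.exp (-(w * s)))
        ((m + 1) * ((s : ℂ) ^ m * Complex.exp (-(w * s))) -
          w * ((s : ℂ) ^ (m + 1) * Complex.exp (-(w * s)))) s := by
      intro s _
      have h1 : HasDerivAt (fun z : ℂ => z ^ (m + 1) * Complex.exp (-(w * z)))
          (((m + 1 : ℕ) * (s : ℂ) ^ m) * Complex.exp (-(w * s)) +
            (s : ℂ) ^ (m + 1) * (Complex.exp (-(w * s)) * -(w * 1))) (s : ℂ) :=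
        (hasDerivAt_pow (m + 1) (s : ℂ)).mul (((hasDerivAt_id _).const_mul w).neg.cexp)
      convert! h1.comp_ofReal using 1
      push_cast; ring
    have i1 := integrableOn_pow_mul_cexp hw m
    have i2 := integrableOn_pow_mul_cexp hw (m + 1)
    have ht : Tendsto (fun s : ℝ => (s : ℂ) ^ (m + 1) * Complex.exp (-(w * s))) atTop (𝓝 0) := by
      rw [tendsto_zero_iff_norm_tendsto_zero]
      have := Real.tendsto_pow_mul_exp_neg_atTop_nhds_zero (m + 1)
      have h2 := ((this.comp (tendsto_id.const_mul_atTop hw)).const_mul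
        ((w.re ^ (m + 1))⁻¹))
      rw [mul_zero] at h2
      refine h2.congr' ?_
      filter_upwards [eventually_ge_atTop 0] with s hs
      simp only [Function.comp, id]
      rw [norm_mul, Complex.norm_exp, norm_pow, Complex.norm_real, Real.norm_of_nonneg hs, mul_pow]
      have : w.re ^ (m + 1) ≠ 0 := by positivity
      field_simp
      simp
    have key := integral_Ioi_of_hasDerivAt_of_tendsto' hd
      ((i1.const_mul ((m : ℂ) + 1)).sub (i2.const_mul w)) ht
    rw [integral_sub (i1.const_mul ((m : ℂ) + 1)) (i2.const_mul w), integral_const_mul,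
      integral_const_mul, ih] at key
    simp only [Complex.ofReal_zero, ne_eq, Nat.add_eq_zero_iff, one_ne_zero, and_false,
      not_false_eq_true, zero_pow, zero_mul, sub_zero] at key
    rw [eq_div_iff (pow_ne_zero _ hw0), pow_succ]
    rw [sub_eq_zero, mul_div_assoc', div_eq_iff (pow_ne_zero _ hw0)] at key
    rw [Nat.factorial_succ]
    push_cast
    rw [key]
    ring

/-- The Cauchy kernel `1 / (t - ic - x)^{m+1}` acts boundedly on `L²`. -/
theorem eLpNorm_cauchy_lower_le {f : ℝ → ℂ} (hf : Integrable f) (hf2 : MemLp f 2) {c : ℝ}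
    (hc : 0 < c) (m : ℕ) :
    eLpNorm (fun x : ℝ => ∫ t : ℝ, f t / ((t : ℂ) - c * Complex.I - x) ^ (m + 1)) 2 volume ≤
      ENNReal.ofReal (2 * Real.pi / c ^ m) * eLpNorm f 2 volume := by
  have hpi := Real.pi_pos
  set w0 : ℂ := 2 * Real.pi * c with hw0
  have hw0re : w0.re = 2 * Real.pi * c := by simp [hw0]
  have hw0pos : 0 < w0.re := by rw [hw0re]; positivity
  -- `2πi (t - ic - x)` has real part `2πc > 0`, so its inverse power `m + 1` is a Laplace integral:
  -- up to `m!`, the Fourier transform of `k ξ * exp (2πi x ξ)`. The Cauchy integral is therefore a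
  -- constant times the inverse transform of `k * 𝓕 f`, and by Plancherel only the supremum of `k`
  -- matters.
  let k : ℝ → ℂ := (Ioi (0 : ℝ)).indicator fun ξ => (ξ : ℂ) ^ m * Complex.exp (-(w0 * ξ))
  have hk : Integrable k := (integrableOn_pow_mul_cexp hw0pos m).integrable_indicator
    measurableSet_Ioi
  -- From `s ^ m / m! ≤ exp s`. Against the prefactor `2π (2π) ^ m / m!` it leaves exactly `2π / c ^
  -- m`.
  set B : ℝ := m.factorial / (2 * Real.pi * c) ^ m with hB
  have hkb : ∀ ξ, ‖k ξ‖ ≤ B := by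
    intro ξ
    by_cases h : ξ ∈ Ioi (0 : ℝ)
    · have h' : 0 < ξ := h
      have := pow_mul_exp_neg_le (by positivity : 0 < 2 * Real.pi * c) h'.le m
      simp only [k, indicator_of_mem h]
      rw [norm_mul, Complex.norm_exp, norm_pow, Complex.norm_real, Real.norm_of_nonneg h'.le]
      have e1 : (-(w0 * (ξ : ℂ))).re = -(2 * Real.pi * c * ξ) := by simp [hw0]
      rwa [e1]
    · simp only [k, indicator_of_notMem h, norm_zero]; positivity
  have hFc : Continuous (𝓕 f) := VectorFourier.fourierIntegral_continuous
    Real.continuous_fourierChar continuous_inner hf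
  have hF2 := memLp_fourier hf hf2
  have hFb : ∀ ξ, ‖𝓕 f ξ‖ ≤ ∫ t, ‖f t‖ := fun ξ =>
    VectorFourier.norm_fourierIntegral_le_integral_norm _ _ _ _ _
  let φ : ℝ → ℂ := fun ξ => k ξ * 𝓕 f ξ
  have hφ : Integrable φ :=
    hk.mul_bdd hFc.aestronglyMeasurable (Eventually.of_forall hFb)
  have hφle : ∀ ξ, ‖φ ξ‖ ≤ B * ‖𝓕 f ξ‖ := fun ξ => by
    rw [norm_mul]; gcongr; exact hkb ξ
  have hφ2 : MemLp φ 2 := hF2.of_le_mul hφ.1 (Eventually.of_forall hφle)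
  have hφn : eLpNorm φ 2 volume ≤ ENNReal.ofReal B * eLpNorm f 2 volume := by
    rw [← eLpNorm_fourier_eq hf hf2]
    exact eLpNorm_le_mul_eLpNorm_of_ae_le_mul (Eventually.of_forall hφle) 2
  have key : ∀ x : ℝ, ∫ t : ℝ, f t / ((t : ℂ) - c * Complex.I - x) ^ (m + 1) =
      (2 * Real.pi * (2 * Real.pi * Complex.I) ^ m / m.factorial * Complex.I) * 𝓕 φ (-x) := by
    intro x
    let e : ℝ → ℂ := fun ξ => k ξ * Complex.exp (2 * Real.pi * x * ξ * Complex.I)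
    have he : Integrable e := by
      refine hk.mul_bdd (c := 1) (by fun_prop) (Eventually.of_forall fun ξ => ?_)
      have : (2 * Real.pi * x * ξ * Complex.I : ℂ) = ((2 * Real.pi * x * ξ : ℝ) : ℂ) * Complex.I := by
        push_cast; ring
      rw [this, Complex.norm_exp_ofReal_mul_I]
    have h1 := VectorFourier.integral_fourierIntegral_smul_eq_flip (L := innerₗ ℝ) (μ := volume)
      (ν := volume) (f := f) (g := e) Real.continuous_fourierChar continuous_inner hf he
    rw [flip_innerₗ] at h1
    have h2 : 𝓕 φ (-x) = ∫ ξ, 𝓕 f ξ • e ξ := by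
      rw [Real.fourier_real_eq_integral_exp_smul]
      refine integral_congr_ae (Eventually.of_forall fun ξ => ?_)
      simp only [φ, e, smul_eq_mul]
      have : ((-2 * Real.pi * ξ * -x : ℝ) : ℂ) * Complex.I = 2 * Real.pi * x * ξ * Complex.I := by
        push_cast; ring
      rw [this]; ring
    have h3 : ∀ t : ℝ, 𝓕 e t =
        m.factorial / (2 * Real.pi * Complex.I * ((t : ℂ) - c * Complex.I - x)) ^ (m + 1) := by
      intro t
      have hwre : (2 * Real.pi * Complex.I * ((t : ℂ) - c * Complex.I - x)).re
          = 2 * Real.pi * c := by simp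
      rw [← integral_pow_mul_cexp (by rw [hwre]; positivity) m,
        Real.fourier_real_eq_integral_exp_smul, ← integral_indicator measurableSet_Ioi]
      refine integral_congr_ae (Eventually.of_forall fun ξ => ?_)
      by_cases h : ξ ∈ Ioi (0 : ℝ)
      · simp only [e, k, indicator_of_mem h, smul_eq_mul]
        rw [mul_left_comm, mul_assoc, ← Complex.exp_add, ← Complex.exp_add]
        congr 2
        rw [hw0]
        push_cast
        linear_combination (-(2 * Real.pi * c * ξ) : ℂ) * Complex.I_sq
      · simp [e, k, indicator_of_notMem h]
    rw [h2]
    have h4 : ∫ ξ, 𝓕 f ξ • e ξ = ∫ t, f t • 𝓕 e t := h1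
    rw [h4, ← integral_const_mul]
    refine integral_congr_ae (Eventually.of_forall fun t => ?_)
    simp only [h3, smul_eq_mul]
    have hne : ((t : ℂ) - c * Complex.I - x) ≠ 0 := by
      intro h0
      have := congrArg Complex.im h0
      simp at this
      exact hc.ne' this
    have hpi' : (Real.pi : ℂ) ≠ 0 := by exact_mod_cast hpi.ne'
    have hfac : (m.factorial : ℂ) ≠ 0 := by exact_mod_cast m.factorial_ne_zero
    rw [mul_pow _ _ (m + 1), pow_succ (2 * Real.pi * Complex.I : ℂ) m]
    have hI := Complex.I_ne_zero
    field_simp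
  have hshift : eLpNorm (fun x : ℝ => 𝓕 φ (-x)) 2 volume = eLpNorm φ 2 volume := by
    rw [← eLpNorm_fourier_eq hφ hφ2]
    exact eLpNorm_comp_measurePreserving (memLp_fourier hφ hφ2).1
      (Measure.measurePreserving_neg volume)
  simp_rw [key]
  have hsm := eLpNorm_const_smul
    (2 * Real.pi * (2 * Real.pi * Complex.I) ^ m / m.factorial * Complex.I : ℂ)
    (fun x : ℝ => 𝓕 φ (-x)) 2 volume
  have hsm' : eLpNorm (fun x : ℝ => (2 * Real.pi * (2 * Real.pi * Complex.I) ^ m / m.factorial *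
      Complex.I : ℂ) * 𝓕 φ (-x)) 2 volume = _ := hsm
  rw [hsm', hshift]
  refine (mul_le_mul_right hφn _).trans ?_
  rw [← mul_assoc, ← ofReal_norm, ← ENNReal.ofReal_mul (norm_nonneg _)]
  gcongr
  apply le_of_eq
  simp only [norm_mul, norm_div, norm_pow, Complex.norm_I, Complex.norm_real,
    Real.norm_of_nonneg hpi.le, Complex.norm_natCast, Complex.norm_ofNat]
  rw [hB]
  have : (m.factorial : ℝ) ≠ 0 := by exact_mod_cast m.factorial_ne_zero
  rw [mul_pow (2 * Real.pi) c]
  field_simp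

/-- Conjugating `f` exchanges the two half-planes and preserves all norms. -/
theorem eLpNorm_cauchy_upper_le {f : ℝ → ℂ} (hf : Integrable f) (hf2 : MemLp f 2) {c : ℝ}
    (hc : 0 < c) (m : ℕ) :
    eLpNorm (fun x : ℝ => ∫ t : ℝ, f t / ((t : ℂ) + c * Complex.I - x) ^ (m + 1)) 2 volume ≤
      ENNReal.ofReal (2 * Real.pi / c ^ m) * eLpNorm f 2 volume := by
  have hsf : Integrable (star f) := by
    have := (Complex.conjLIE.toContinuousLinearEquiv.integrable_comp_iff (μ := volume) (φ := f)).2 hf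
    exact this
  have h := eLpNorm_cauchy_lower_le hsf hf2.star hc m
  have e1 : eLpNorm (star f) 2 volume = eLpNorm f 2 volume :=
    eLpNorm_congr_norm_ae (Eventually.of_forall fun x => by simp)
  rw [e1] at h
  refine le_trans (le_of_eq ?_) h
  refine eLpNorm_congr_norm_ae (Eventually.of_forall fun x => ?_)
  rw [← RCLike.norm_conj (∫ t : ℝ, _), ← integral_conj]
  simp [sub_eq_add_neg]

end

/-! ### Contour integrals over a rectangle -/

section

open Set Complex

/-- The contour integral of `F` over the boundary of `[-R, R] × [-b, b]`. -/
def rectIntegral (R b : ℝ) (F : ℂ → ℂ) : ℂ :=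
  (∫ t in (-R)..R, F (t - b * I)) - (∫ t in (-R)..R, F (t + b * I)) +
    I * (∫ y in (-b)..b, F (R + y * I)) - I * (∫ y in (-b)..b, F (-R + y * I))

/-- The boundary of `[-R, R] × [-b, b]`. -/
def rectBoundary (R b : ℝ) : Set ℂ :=
  {z | (|z.re| = R ∧ |z.im| ≤ b) ∨ (|z.im| = b ∧ |z.re| ≤ R)}

section rect
variable {R b : ℝ}

theorem bottom_mem_rectBoundary (hb : 0 ≤ b) {t : ℝ} (ht : t ∈ Icc (-R) R) :
    (t - b * I : ℂ) ∈ rectBoundary R b :=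
  Or.inr ⟨by simp [abs_of_nonneg hb], by simpa using abs_le.2 ht⟩

theorem top_mem_rectBoundary (hb : 0 ≤ b) {t : ℝ} (ht : t ∈ Icc (-R) R) :
    (t + b * I : ℂ) ∈ rectBoundary R b :=
  Or.inr ⟨by simp [abs_of_nonneg hb], by simpa using abs_le.2 ht⟩

theorem right_mem_rectBoundary (hR : 0 ≤ R) {y : ℝ} (hy : y ∈ Icc (-b) b) :
    (R + y * I : ℂ) ∈ rectBoundary R b :=
  Or.inl ⟨by simp [abs_of_nonneg hR], by simpa using abs_le.2 hy⟩

theorem left_mem_rectBoundary (hR : 0 ≤ R) {y : ℝ} (hy : y ∈ Icc (-b) b) :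
    (-R + y * I : ℂ) ∈ rectBoundary R b :=
  Or.inl ⟨by simp [abs_of_nonneg hR], by simpa using abs_le.2 hy⟩

theorem ne_of_mem_rectBoundary {z a : ℂ} (hz : z ∈ rectBoundary R b) (ha : |a.re| < R)
    (ha' : |a.im| < b) : z - a ≠ 0 := by
  rintro h
  obtain rfl := sub_eq_zero.1 h
  rcases hz with h | h
  · exact ha.ne h.1
  · exact ha'.ne h.1

theorem continuousOn_bottom (hb : 0 ≤ b) {F : ℂ → ℂ} (hF : ContinuousOn F (rectBoundary R b)) :
    ContinuousOn (fun t : ℝ => F (t - b * I)) (Icc (-R) R) :=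
  hF.comp (by fun_prop) fun _ ht => bottom_mem_rectBoundary hb ht

theorem continuousOn_top (hb : 0 ≤ b) {F : ℂ → ℂ} (hF : ContinuousOn F (rectBoundary R b)) :
    ContinuousOn (fun t : ℝ => F (t + b * I)) (Icc (-R) R) :=
  hF.comp (by fun_prop) fun _ ht => top_mem_rectBoundary hb ht

theorem continuousOn_right (hR : 0 ≤ R) {F : ℂ → ℂ} (hF : ContinuousOn F (rectBoundary R b)) :
    ContinuousOn (fun y : ℝ => F (R + y * I)) (Icc (-b) b) :=
  hF.comp (by fun_prop) fun _ ht => right_mem_rectBoundary hR ht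

theorem continuousOn_left (hR : 0 ≤ R) {F : ℂ → ℂ} (hF : ContinuousOn F (rectBoundary R b)) :
    ContinuousOn (fun y : ℝ => F (-R + y * I)) (Icc (-b) b) :=
  hF.comp (by fun_prop) fun _ ht => left_mem_rectBoundary hR ht

theorem rectIntegral_congr (hR : 0 ≤ R) (hb : 0 ≤ b) {F G : ℂ → ℂ}
    (h : EqOn F G (rectBoundary R b)) : rectIntegral R b F = rectIntegral R b G := by
  have hR' : -R ≤ R := by linarith
  have hb' : -b ≤ b := by linarith
  unfold rectIntegral
  congr 1
  · congr 1
    · congr 1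
      · exact intervalIntegral.integral_congr fun t ht =>
          h (bottom_mem_rectBoundary hb (by rwa [uIcc_of_le hR'] at ht))
      · exact intervalIntegral.integral_congr fun t ht =>
          h (top_mem_rectBoundary hb (by rwa [uIcc_of_le hR'] at ht))
    · congr 1
      exact intervalIntegral.integral_congr fun t ht =>
          h (right_mem_rectBoundary hR (by rwa [uIcc_of_le hb'] at ht))
  · congr 1
    exact intervalIntegral.integral_congr fun t ht =>
          h (left_mem_rectBoundary hR (by rwa [uIcc_of_le hb'] at ht))

theorem rectIntegral_add (hR : 0 ≤ R) (hb : 0 ≤ b) {F G : ℂ → ℂ}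
    (hF : ContinuousOn F (rectBoundary R b)) (hG : ContinuousOn G (rectBoundary R b)) :
    rectIntegral R b (fun z => F z + G z) = rectIntegral R b F + rectIntegral R b G := by
  have hR' : -R ≤ R := by linarith
  have hb' : -b ≤ b := by linarith
  unfold rectIntegral
  rw [intervalIntegral.integral_add, intervalIntegral.integral_add,
    intervalIntegral.integral_add, intervalIntegral.integral_add]
  · ring
  all_goals apply ContinuousOn.intervalIntegrable
  all_goals first | rw [uIcc_of_le hR'] | rw [uIcc_of_le hb']
  · exact continuousOn_left hR hF
  · exact continuousOn_left hR hG
  · exact continuousOn_right hR hF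
  · exact continuousOn_right hR hG
  · exact continuousOn_top hb hF
  · exact continuousOn_top hb hG
  · exact continuousOn_bottom hb hF
  · exact continuousOn_bottom hb hG

theorem rectIntegral_const_mul (c : ℂ) (F : ℂ → ℂ) :
    rectIntegral R b (fun z => c * F z) = c * rectIntegral R b F := by
  unfold rectIntegral
  simp only [intervalIntegral.integral_const_mul]
  ring

theorem rectIntegral_sum (hR : 0 ≤ R) (hb : 0 ≤ b) {ι : Type*} (s : Finset ι) {F : ι → ℂ → ℂ}
    (hF : ∀ i ∈ s, ContinuousOn (F i) (rectBoundary R b)) :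
    rectIntegral R b (fun z => ∑ i ∈ s, F i z) = ∑ i ∈ s, rectIntegral R b (F i) := by
  classical
  induction s using Finset.induction_on with
  | empty => simp [rectIntegral]
  | insert i s hi ih =>
    simp only [Finset.sum_insert hi]
    rw [rectIntegral_add hR hb (hF i (Finset.mem_insert_self _ _))
      (continuousOn_finsetSum _ fun j hj => hF j (Finset.mem_insert_of_mem hj)),
      ih fun j hj => hF j (Finset.mem_insert_of_mem hj)]

theorem rectIntegral_eq_zero {F : ℂ → ℂ}
    (hF : DifferentiableOn ℂ F (uIcc (-R) R ×ℂ uIcc (-b) b)) : rectIntegral R b F = 0 := by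
  have := integral_boundary_rect_eq_zero_of_differentiableOn F (-R - b * I) (R + b * I)
    (by simpa using hF)
  simpa [rectIntegral, sub_eq_add_neg] using this

theorem hasDerivAt_log_affine {p q : ℂ} {t : ℝ} (h : p + t * q ∈ slitPlane) :
    HasDerivAt (fun t : ℝ => log (p + t * q)) (q / (p + t * q)) t := by
  have h1 : HasDerivAt (fun z : ℂ => p + z * q) q (t : ℂ) := by
    simpa using ((hasDerivAt_id (t : ℂ)).mul_const q).const_add p
  exact (h1.clog h).comp_ofReal

theorem intervalIntegral_inv_affine {p q : ℂ} {u v : ℝ} (huv : u ≤ v)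
    (h : ∀ t ∈ Icc u v, p + t * q ∈ slitPlane) :
    ∫ t in u..v, q / (p + t * q) = log (p + v * q) - log (p + u * q) := by
  refine intervalIntegral.integral_eq_sub_of_hasDerivAt (f := fun t : ℝ => log (p + t * q))
    (fun t ht => hasDerivAt_log_affine (h t (by rwa [uIcc_of_le huv] at ht))) ?_
  refine ContinuousOn.intervalIntegrable ?_
  rw [uIcc_of_le huv]
  exact continuousOn_const.div (by fun_prop) fun t ht => slitPlane_ne_zero (h t ht)

theorem log_sub_log_neg_of_im_pos {w : ℂ} (hw : 0 < w.im) : log w - log (-w) = Real.pi * I := by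
  rw [log, log, norm_neg, arg_neg_eq_arg_sub_pi_of_im_pos hw]
  push_cast; ring

theorem log_sub_log_neg_of_im_neg {w : ℂ} (hw : w.im < 0) :
    log w - log (-w) = -(Real.pi * I) := by
  rw [log, log, norm_neg, arg_neg_eq_arg_add_pi_of_im_neg hw]
  push_cast; ring

/-- The principal logarithm is a primitive on three sides. The left side meets its cut, so `log (-(z
- a))` is used there, and the mismatch at the two left corners contributes `πi` each. -/
theorem rectIntegral_inv_sub {a : ℂ} (ha : |a.re| < R) (hb : |a.im| < b) :
    rectIntegral R b (fun z => 1 / (z - a)) = 2 * Real.pi * I := by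
  obtain ⟨ha1, ha2⟩ := abs_lt.1 ha
  obtain ⟨hb1, hb2⟩ := abs_lt.1 hb
  have e1 : ∫ t in (-R)..R, 1 / ((t - b * I : ℂ) - a) =
      log (R - b * I - a) - log (-R - b * I - a) := by
    have := intervalIntegral_inv_affine (p := -b * I - a) (q := 1) (u := -R) (v := R)
      (by linarith) fun t _ => Or.inr (by simp; linarith)
    convert! this using 3
    · ring
    · ring
    · push_cast; ring
  have e2 : ∫ t in (-R)..R, 1 / ((t + b * I : ℂ) - a) =
      log (R + b * I - a) - log (-R + b * I - a) := by
    have := intervalIntegral_inv_affine (p := b * I - a) (q := 1) (u := -R) (v := R)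
      (by linarith) fun t _ => Or.inr (by simp; linarith)
    convert! this using 3
    · ring
    · ring
    · push_cast; ring
  have e3 : I * ∫ y in (-b)..b, 1 / ((R + y * I : ℂ) - a) =
      log (R + b * I - a) - log (R - b * I - a) := by
    have := intervalIntegral_inv_affine (p := R - a) (q := I) (u := -b) (v := b)
      (by linarith) fun t _ => Or.inl (by simp; linarith)
    rw [← intervalIntegral.integral_const_mul]
    convert! this using 3
    · ring
    · ring
    · push_cast; ring
  have e4 : I * ∫ y in (-b)..b, 1 / ((-R + y * I : ℂ) - a) =
      log (-(-R + b * I - a)) - log (-(-R - b * I - a)) := by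
    have := intervalIntegral_inv_affine (p := R + a) (q := -I) (u := -b) (v := b)
      (by linarith) fun t _ => Or.inl (by simp; linarith)
    rw [← intervalIntegral.integral_const_mul]
    convert! this using 3
    · rw [mul_one_div, ← neg_div_neg_eq]
      congr 1; ring
    · ring
    · push_cast; ring
  have l1 := log_sub_log_neg_of_im_pos (w := -R + b * I - a) (by simp; linarith)
  have l2 := log_sub_log_neg_of_im_neg (w := -R - b * I - a) (by simp; linarith)
  rw [rectIntegral, e1, e2, e3, e4]
  linear_combination l1 - l2

/-- Partial fractions: the residues at `a` and `x` are opposite. -/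
theorem rectIntegral_inv_mul_inv {a x : ℂ} (hax : a ≠ x) (ha : |a.re| < R) (ha' : |a.im| < b)
    (hx : |x.re| < R) (hx' : |x.im| < b) :
    rectIntegral R b (fun z => 1 / ((z - a) * (z - x))) = 0 := by
  have hR : 0 ≤ R := (abs_nonneg _).trans hx.le
  have hb : 0 ≤ b := (abs_nonneg _).trans hx'.le
  have hax' : a - x ≠ 0 := sub_ne_zero.2 hax
  have c1 : ∀ {c a : ℂ}, |a.re| < R → |a.im| < b →
      ContinuousOn (fun z => c * (1 / (z - a))) (rectBoundary R b) := fun h1 h2 =>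
    continuousOn_const.mul (continuousOn_const.div (by fun_prop)
      fun z hz => ne_of_mem_rectBoundary hz h1 h2)
  rw [rectIntegral_congr hR hb (G := fun z =>
    (1 / (a - x)) * (1 / (z - a)) + (-(1 / (a - x))) * (1 / (z - x)))]
  · rw [rectIntegral_add hR hb (c1 ha ha') (c1 hx hx'), rectIntegral_const_mul,
      rectIntegral_const_mul, rectIntegral_inv_sub ha ha', rectIntegral_inv_sub hx hx']
    ring
  · intro z hz
    have h1 := ne_of_mem_rectBoundary hz ha ha'
    have h2 := ne_of_mem_rectBoundary hz hx hx'
    simp only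
    field_simp
    ring

theorem rectIntegral_div_sub {F : ℂ → ℂ} (hF : DifferentiableOn ℂ F (uIcc (-R) R ×ℂ uIcc (-b) b))
    {x : ℂ} (hx : |x.re| < R) (hx' : |x.im| < b) :
    rectIntegral R b (fun z => F z / (z - x)) = 2 * Real.pi * I * F x := by
  have hR : 0 ≤ R := (abs_nonneg _).trans hx.le
  have hb : 0 ≤ b := (abs_nonneg _).trans hx'.le
  have hR' : -R ≤ R := by linarith
  have hb' : -b ≤ b := by linarith
  have hnhds : uIcc (-R) R ×ℂ uIcc (-b) b ∈ 𝓝 x := by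
    rw [uIcc_of_le hR', uIcc_of_le hb']
    refine mem_of_superset ((isOpen_Ioo.reProdIm isOpen_Ioo).mem_nhds
      (⟨abs_lt.1 hx, abs_lt.1 hx'⟩ : x ∈ Ioo (-R) R ×ℂ Ioo (-b) b)) ?_
    exact reProdIm_subset_iff.2 (prod_mono Ioo_subset_Icc_self Ioo_subset_Icc_self)
  have hd := (differentiableOn_dslope hnhds).2 hF
  have hsub : rectBoundary R b ⊆ uIcc (-R) R ×ℂ uIcc (-b) b := by
    intro z hz
    rw [uIcc_of_le hR', uIcc_of_le hb']
    rcases hz with h | h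
    · exact ⟨abs_le.1 h.1.le, abs_le.1 h.2⟩
    · exact ⟨abs_le.1 h.2, abs_le.1 h.1.le⟩
  rw [rectIntegral_congr hR hb (G := fun z => dslope F x z + F x * (1 / (z - x)))]
  · have hc : ContinuousOn (fun z => F x * (1 / (z - x))) (rectBoundary R b) :=
      continuousOn_const.mul (continuousOn_const.div (by fun_prop)
        fun z hz => ne_of_mem_rectBoundary hz hx hx')
    rw [rectIntegral_add hR hb (hd.continuousOn.mono hsub) hc, rectIntegral_eq_zero hd,
      rectIntegral_const_mul, rectIntegral_inv_sub hx hx']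
    ring
  · intro z hz
    have h2 := ne_of_mem_rectBoundary hz hx hx'
    simp only
    rw [dslope_of_ne _ (sub_ne_zero.1 h2), slope_def_field]
    field_simp
    ring

end rect

/-- At a common zero, both functions are `z - a` times their slope functions, which are holomorphic;
the factor cancels and the slope of `s` is nonzero at `a` because the zero is simple. -/
theorem differentiableAt_quot {E s : ℂ → ℂ} {a : ℂ} {U : Set ℂ} (hU : U ∈ 𝓝 a)
    (hE : DifferentiableOn ℂ E U) (hs : DifferentiableOn ℂ s U)
    (h0 : s a = 0 → E a = 0 ∧ deriv s a ≠ 0) :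
    DifferentiableAt ℂ (fun z => if s z = 0 then deriv E z / deriv s z else E z / s z) a := by
  classical
  by_cases ha : s a = 0
  · obtain ⟨hEa, hsa⟩ := h0 ha
    have dE := ((differentiableOn_dslope hU).2 hE).differentiableAt hU
    have ds := ((differentiableOn_dslope hU).2 hs).differentiableAt hU
    have hne : dslope s a a ≠ 0 := by rwa [dslope_same]
    refine (dE.fun_div ds hne).congr_of_eventuallyEq ?_
    filter_upwards [ds.continuousAt.eventually_ne hne] with z hz
    have e1 := sub_smul_dslope E a z
    have e2 := sub_smul_dslope s a z
    rw [hEa, sub_zero, smul_eq_mul] at e1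
    rw [ha, sub_zero, smul_eq_mul] at e2
    by_cases hza : z = a
    · subst hza
      rw [if_pos ha, dslope_same, dslope_same]
    · have hza' := sub_ne_zero.2 hza
      rw [← e1, ← e2, if_neg (mul_ne_zero hza' hz), mul_div_mul_left _ _ hza']
  · refine ((hE.differentiableAt hU).fun_div (hs.differentiableAt hU) ha).congr_of_eventuallyEq ?_
    filter_upwards [(hs.differentiableAt hU).continuousAt.eventually_ne ha] with z hz
    rw [if_neg hz]

end

/-! ### The Sinc interpolation error as a contour integral -/

section

open Set Complex

/-- The entire function `sin z / z`. -/
def csinc : ℂ → ℂ := dslope Complex.sin 0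

theorem differentiable_csinc : Differentiable ℂ csinc := by
  rw [← differentiableOn_univ]
  exact (differentiableOn_dslope univ_mem).2 differentiable_sin.differentiableOn

theorem csinc_of_ne_zero {z : ℂ} (hz : z ≠ 0) : csinc z = Complex.sin z / z := by
  rw [csinc, dslope_of_ne _ hz, slope_def_field]; simp

@[simp] theorem csinc_zero : csinc 0 = 1 := by
  rw [csinc, dslope_same, Complex.deriv_sin, Complex.cos_zero]

theorem csinc_ofReal (x : ℝ) : csinc x = Real.sinc x := by
  by_cases hx : x = 0
  · simp [hx]
  · rw [csinc_of_ne_zero (by exact_mod_cast hx), Real.sinc_of_ne_zero hx]; push_cast; rfl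

/-- `sin (π z / h)`. -/
def csin (h : ℝ) (z : ℂ) : ℂ := Complex.sin (Real.pi * (z / h))

theorem differentiable_csin (h : ℝ) : Differentiable ℂ (csin h) := by
  unfold csin; fun_prop

/-- The Sinc basis as an entire function. -/
def csincBasis (k : ℤ) (h : ℝ) (z : ℂ) : ℂ := csinc (Real.pi * ((z - k * h) / h))

theorem differentiable_csincBasis (k : ℤ) (h : ℝ) : Differentiable ℂ (csincBasis k h) := by
  unfold csincBasis
  exact differentiable_csinc.comp (by fun_prop)

theorem csincBasis_ofReal (k : ℤ) (h x : ℝ) : csincBasis k h x = sincBasis k h x := by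
  rw [csincBasis, sincBasis, ← csinc_ofReal]; push_cast; rfl

section
variable {h : ℝ}

theorem csin_eq_zero_iff (hh : h ≠ 0) {z : ℂ} : csin h z = 0 ↔ ∃ k : ℤ, z = k * h := by
  have hh' : (h : ℂ) ≠ 0 := by exact_mod_cast hh
  have hpi : (Real.pi : ℂ) ≠ 0 := by exact_mod_cast Real.pi_ne_zero
  rw [csin, Complex.sin_eq_zero_iff]
  refine exists_congr fun k => ?_
  rw [mul_comm (k : ℂ), mul_right_inj' hpi, div_eq_iff hh']

theorem deriv_csin_ne_zero (hh : h ≠ 0) (k : ℤ) : deriv (csin h) (k * h) ≠ 0 := by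
  have hh' : (h : ℂ) ≠ 0 := by exact_mod_cast hh
  have hpi : (Real.pi : ℂ) ≠ 0 := by exact_mod_cast Real.pi_ne_zero
  have hd : HasDerivAt (csin h) (Complex.cos (Real.pi * ((k * h : ℂ) / h)) * (Real.pi * (1 / h)))
      (k * h) := (((hasDerivAt_id (k * h : ℂ)).div_const (h : ℂ)).const_mul (Real.pi : ℂ)).csin
  rw [hd.deriv, mul_div_cancel_right₀ _ hh', mul_comm (Real.pi : ℂ)]
  refine mul_ne_zero ?_ (mul_ne_zero hpi (one_div_ne_zero hh'))
  intro h0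
  have := Complex.sin_sq_add_cos_sq (k * Real.pi)
  simp [h0, Complex.sin_int_mul_pi] at this

theorem csincBasis_eq (hh : h ≠ 0) (k : ℤ) {z : ℂ} (hz : csin h z ≠ 0) :
    csincBasis k h z = h / Real.pi * Complex.cos (k * Real.pi) * csin h z / (z - k * h) := by
  have hh' : (h : ℂ) ≠ 0 := by exact_mod_cast hh
  have hpi : (Real.pi : ℂ) ≠ 0 := by exact_mod_cast Real.pi_ne_zero
  have hzk : z - k * h ≠ 0 := fun e => hz ((csin_eq_zero_iff hh).2 ⟨k, sub_eq_zero.1 e⟩)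
  rw [csincBasis, csinc_of_ne_zero (by positivity)]
  have e : (Real.pi * ((z - k * h) / h) : ℂ) = Real.pi * (z / h) - k * Real.pi := by
    field_simp
  rw [e, Complex.sin_sub, Complex.sin_int_mul_pi, mul_zero, sub_zero, ← csin]
  have e' : (Real.pi * (z / h) - k * Real.pi : ℂ) = Real.pi * (z - k * h) / h := by
    field_simp
  rw [e']
  field_simp

theorem csincBasis_node (hh : h ≠ 0) (k j : ℤ) :
    csincBasis k h (j * h) = if k = j then 1 else 0 := by
  have hh' : (h : ℂ) ≠ 0 := by exact_mod_cast hh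
  have hpi : (Real.pi : ℂ) ≠ 0 := by exact_mod_cast Real.pi_ne_zero
  rw [csincBasis]
  have e : (Real.pi * ((j * h - k * h : ℂ) / h) : ℂ) = ((j - k : ℤ) : ℂ) * Real.pi := by
    push_cast; field_simp
  rw [e]
  split_ifs with hkj
  · subst hkj; simp
  · rw [csinc_of_ne_zero, Complex.sin_int_mul_pi, zero_div]
    refine mul_ne_zero ?_ hpi
    exact_mod_cast sub_ne_zero.2 (Ne.symm hkj)

/-- The sine vanishes only at the nodes; on the vertical sides parity excludes `2 |k| = 2 K + 1`. -/
theorem csin_ne_zero_of_mem_rectBoundary (hh : 0 < h) (K : ℕ) {b : ℝ} (hb : 0 < b) {z : ℂ}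
    (hz : z ∈ rectBoundary ((K + 1 / 2) * h) b) : csin h z ≠ 0 := by
  intro h0
  obtain ⟨k, rfl⟩ := (csin_eq_zero_iff hh.ne').1 h0
  rcases hz with h1 | h1
  · have h2 := h1.1
    simp only [mul_re, intCast_re, ofReal_re, intCast_im, ofReal_im, mul_zero, sub_zero] at h2
    rw [abs_mul, abs_of_pos hh, mul_left_inj' hh.ne'] at h2
    have h3 : ((2 * |k| : ℤ) : ℝ) = ((2 * K + 1 : ℤ) : ℝ) := by push_cast; linarith
    have h4 : 2 * |k| = 2 * (K : ℤ) + 1 := by exact_mod_cast h3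
    omega
  · have h2 := h1.1
    simp at h2
    exact hb.ne h2

/-- The interpolation error on `[-(K+1/2)h, (K+1/2)h]` as a contour integral. -/
theorem sub_truncSinc_eq (hh : 0 < h) (K : ℕ) {d b : ℝ} (hb : 0 < b) (hbd : b < d) {g : ℂ → ℂ}
    (hg : AnalyticOnNhd ℂ g (strip d)) {x : ℝ} (hx : |x| < (K + 1 / 2) * h)
    (hx0 : csin h x ≠ 0) :
    g x - truncSinc g K K h x = csin h x / (2 * Real.pi * I) *
      rectIntegral ((K + 1 / 2) * h) b (fun z => g z / csin h z / (z - x)) := by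
  set R : ℝ := (K + 1 / 2) * h with hR
  have hR0 : 0 < R := by positivity
  set S := Finset.Icc (-(K : ℤ)) (K : ℤ) with hS
  let E : ℂ → ℂ := fun z => g z - ∑ k ∈ S, g ((k * h : ℝ) : ℂ) * csincBasis k h z
  -- The zeros of the sine in the closed rectangle are the nodes with `|k| ≤ K`. They are simple and
  -- `E` vanishes there, so `Q` is holomorphic and Cauchy's formula applies to it.
  let Q : ℂ → ℂ := fun z => if csin h z = 0 then deriv E z / deriv (csin h) z else E z / csin h z
  have hopen : IsOpen (strip d) := isOpen_lt (by fun_prop) continuous_const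
  have hE : DifferentiableOn ℂ E (strip d) := by
    refine hg.differentiableOn.sub (DifferentiableOn.fun_sum fun k _ => ?_)
    exact ((differentiable_csincBasis k h).const_mul _).differentiableOn
  have hEn : ∀ j ∈ S, E (j * h) = 0 := by
    intro j hj
    simp only [E]
    rw [Finset.sum_eq_single_of_mem j hj]
    · rw [csincBasis_node hh.ne', if_pos rfl]; simp
    · intro k _ hkj
      rw [csincBasis_node hh.ne', if_neg hkj, mul_zero]
  have hQ : DifferentiableOn ℂ Q (uIcc (-R) R ×ℂ uIcc (-b) b) := by
    intro z hz
    rw [uIcc_of_le (by linarith), uIcc_of_le (by linarith)] at hz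
    have hzs : z ∈ strip d := lt_of_le_of_lt (abs_le.2 hz.2) hbd
    refine (differentiableAt_quot (hopen.mem_nhds hzs) hE
      (differentiable_csin h).differentiableOn fun h0 => ?_).differentiableWithinAt
    obtain ⟨k, rfl⟩ := (csin_eq_zero_iff hh.ne').1 h0
    refine ⟨hEn k ?_, deriv_csin_ne_zero hh.ne' k⟩
    have h1 : |(k * h : ℂ).re| ≤ R := abs_le.2 hz.1
    simp only [mul_re, intCast_re, ofReal_re, intCast_im, ofReal_im, mul_zero, sub_zero] at h1
    rw [abs_mul, abs_of_pos hh, hR, mul_le_mul_iff_left₀ hh] at h1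
    have h2 : ((2 * |k| : ℤ) : ℝ) ≤ ((2 * K + 1 : ℤ) : ℝ) := by push_cast; linarith
    have h3 : 2 * |k| ≤ 2 * (K : ℤ) + 1 := by exact_mod_cast h2
    rw [hS, Finset.mem_Icc]
    exact abs_le.1 (by omega)
  have hxre : |(x : ℂ).re| < R := by simpa using hx
  have hxim : |(x : ℂ).im| < b := by simpa using hb
  have key := rectIntegral_div_sub hQ hxre hxim
  have hbs : ∀ z ∈ rectBoundary R b, z ∈ strip d := by
    intro z hz
    rcases hz with h1 | h1
    · exact lt_of_le_of_lt h1.2 hbd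
    · exact lt_of_eq_of_lt h1.1 hbd
  have hcont : ContinuousOn (fun z => g z / csin h z / (z - x)) (rectBoundary R b) := by
    refine ContinuousOn.div (ContinuousOn.div (hg.continuousOn.mono hbs)
      (differentiable_csin h).continuous.continuousOn fun z hz => ?_) (by fun_prop) fun z hz => ?_
    · exact csin_ne_zero_of_mem_rectBoundary hh K hb hz
    · exact ne_of_mem_rectBoundary hz hxre hxim
  have hkx : ∀ k ∈ S, |(k * h : ℂ).re| < R ∧ |(k * h : ℂ).im| < b := by
    intro k hk
    rw [hS, Finset.mem_Icc] at hk
    constructor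
    · simp only [mul_re, intCast_re, ofReal_re, intCast_im, ofReal_im, mul_zero, sub_zero]
      rw [abs_mul, abs_of_pos hh, hR, mul_lt_mul_iff_left₀ hh]
      have h1 : |k| ≤ K := abs_le.2 hk
      have h2 : ((|k| : ℤ) : ℝ) ≤ ((K : ℤ) : ℝ) := by exact_mod_cast h1
      push_cast at h2
      linarith
    · simpa using hb
  have hterm : ∀ k ∈ S, ContinuousOn (fun z : ℂ =>
      (-(g ((k * h : ℝ) : ℂ) * (h / Real.pi * Complex.cos (k * Real.pi)))) *
        (1 / ((z - k * h) * (z - x)))) (rectBoundary R b) := by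
    intro k hk
    refine continuousOn_const.mul (continuousOn_const.div (by fun_prop) fun z hz => ?_)
    exact mul_ne_zero (ne_of_mem_rectBoundary hz (hkx k hk).1 (hkx k hk).2)
      (ne_of_mem_rectBoundary hz hxre hxim)
  -- Divided by the sine, each Sinc term becomes a constant over `z - k h`. With the extra factor `1
  -- / (z - x)` its contour integral is zero, so only `g` survives.
  have hsplit : rectIntegral R b (fun z => Q z / (z - x)) =
      rectIntegral R b (fun z => g z / csin h z / (z - x)) := by
    rw [rectIntegral_congr hR0.le hb.le (G := fun z => g z / csin h z / (z - x) +
      ∑ k ∈ S, (-(g ((k * h : ℝ) : ℂ) * (h / Real.pi * Complex.cos (k * Real.pi)))) *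
        (1 / ((z - k * h) * (z - x))))]
    · rw [rectIntegral_add hR0.le hb.le hcont (continuousOn_finsetSum _ hterm),
        rectIntegral_sum hR0.le hb.le _ hterm, Finset.sum_eq_zero, add_zero]
      intro k hk
      rw [rectIntegral_const_mul, rectIntegral_inv_mul_inv _ (hkx k hk).1 (hkx k hk).2 hxre hxim,
        mul_zero]
      intro e
      exact hx0 ((csin_eq_zero_iff hh.ne').2 ⟨k, e.symm⟩)
    · intro z hz
      have hsz := csin_ne_zero_of_mem_rectBoundary hh K hb hz
      simp only [Q, if_neg hsz, E]
      rw [sub_div, sub_div, sub_eq_add_neg, add_right_inj, Finset.sum_div, Finset.sum_div,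
        ← Finset.sum_neg_distrib]
      refine Finset.sum_congr rfl fun k hk => ?_
      rw [csincBasis_eq hh.ne' k hsz]
      have h1 := ne_of_mem_rectBoundary hz (hkx k hk).1 (hkx k hk).2
      have h2 := ne_of_mem_rectBoundary hz hxre hxim
      field_simp
  rw [← hsplit, key]
  have hQx : Q x = E x / csin h x := if_neg hx0
  have hEx : E x = g x - truncSinc g K K h x := by
    simp only [E, truncSinc, csincBasis_ofReal]
    rfl
  rw [hQx, ← hEx]
  have : (2 * Real.pi * I : ℂ) ≠ 0 := two_pi_I_ne_zero
  field_simp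

end

end

/-! ### Differentiating the contour representation -/

section

open Set Complex

/-- By compactness the curve stays at distance `2 δ` from `x₀`, hence `δ` from nearby points, which
gives a constant dominating function. -/
theorem hasDerivAt_integral_div_sub_pow {u v : ℝ} (huv : u ≤ v) {φ w : ℝ → ℂ}
    (hφ : ContinuousOn φ (Icc u v)) (hw : ContinuousOn w (Icc u v)) {x₀ : ℝ}
    (h0 : ∀ t ∈ Icc u v, w t - x₀ ≠ 0) (m : ℕ) :
    HasDerivAt (fun x : ℝ => ∫ t in u..v, φ t / (w t - x) ^ (m + 1))
      ((m + 1) * ∫ t in u..v, φ t / (w t - x₀) ^ (m + 2)) x₀ := by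
  obtain ⟨δ, hδ, hδw⟩ : ∃ δ > 0, ∀ t ∈ Icc u v, 2 * δ ≤ ‖w t - x₀‖ := by
    obtain ⟨t₀, ht₀, hmin⟩ := isCompact_Icc.exists_isMinOn (nonempty_Icc.2 huv)
      ((hw.sub (continuousOn_const (c := (x₀ : ℂ)))).norm)
    refine ⟨‖w t₀ - x₀‖ / 2, by have := norm_pos_iff.2 (h0 t₀ ht₀); positivity, fun t ht => ?_⟩
    have : ‖w t₀ - x₀‖ ≤ ‖w t - x₀‖ := hmin ht
    linarith
  obtain ⟨A, hA⟩ := isCompact_Icc.exists_bound_of_continuousOn hφ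
  have hlow : ∀ x ∈ Metric.ball x₀ δ, ∀ t ∈ Icc u v, δ ≤ ‖w t - x‖ := by
    intro x hx t ht
    have h1 : ‖w t - x₀‖ ≤ ‖w t - x‖ + ‖(x : ℂ) - x₀‖ := norm_sub_le_norm_sub_add_norm_sub _ _ _
    rw [← ofReal_sub, norm_real] at h1
    have h2 : ‖x - x₀‖ < δ := by simpa [dist_eq_norm] using hx
    linarith [hδw t ht]
  have hcont : ∀ x ∈ Metric.ball x₀ δ, ∀ m : ℕ,
      ContinuousOn (fun t => φ t / (w t - x) ^ m) (Icc u v) := fun x hx m =>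
    hφ.div ((hw.sub continuousOn_const).pow m) fun t ht =>
      pow_ne_zero _ (norm_pos_iff.1 (hδ.trans_le (hlow x hx t ht)))
  have hx₀ : x₀ ∈ Metric.ball x₀ δ := Metric.mem_ball_self hδ
  have hmeas : ∀ x ∈ Metric.ball x₀ δ, ∀ m : ℕ, AEStronglyMeasurable
      (fun t => φ t / (w t - x) ^ m) (volume.restrict (uIoc u v)) := by
    intro x hx m
    rw [uIoc_of_le huv]
    exact ((hcont x hx m).mono Ioc_subset_Icc_self).aestronglyMeasurable measurableSet_Ioc
  have key := intervalIntegral.hasDerivAt_integral_of_dominated_loc_of_deriv_le (μ := volume)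
    (F := fun (x : ℝ) t => φ t / (w t - x) ^ (m + 1))
    (F' := fun (x : ℝ) t => (m + 1) * (φ t / (w t - x) ^ (m + 2)))
    (bound := fun _ => (m + 1) * (A / δ ^ (m + 2))) (a := u) (b := v)
    (Metric.ball_mem_nhds x₀ hδ)
    (eventually_of_mem (Metric.ball_mem_nhds x₀ hδ) fun x hx => hmeas x hx _)
    (((hcont x₀ hx₀ (m + 1)).mono (by rw [uIcc_of_le huv])).intervalIntegrable)
    ((hmeas x₀ hx₀ (m + 2)).const_mul _) ?_ intervalIntegrable_const ?_
  · have := key.2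
    rwa [intervalIntegral.integral_const_mul] at this
  · refine Eventually.of_forall fun t ht x hx => ?_
    rw [uIoc_of_le huv] at ht
    have ht := Ioc_subset_Icc_self ht
    have h1 := hlow x hx t ht
    rw [norm_mul, norm_div, norm_pow]
    have : ‖((m : ℂ) + 1)‖ = m + 1 := by
      rw [← Nat.cast_succ, Complex.norm_natCast, Nat.cast_succ]
    rw [this]
    have := hA t ht
    have : 0 ≤ A := (norm_nonneg _).trans this
    gcongr
  · refine Eventually.of_forall fun t ht x hx => ?_
    rw [uIoc_of_le huv] at ht
    have ht := Ioc_subset_Icc_self ht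
    have hne : w t - x ≠ 0 := norm_pos_iff.1 (hδ.trans_le (hlow x hx t ht))
    have h1 : HasDerivAt (fun z : ℂ => φ t / (w t - z) ^ (m + 1))
        ((m + 1) * (φ t / (w t - x) ^ (m + 2))) (x : ℂ) := by
      have h2 : HasDerivAt (fun z : ℂ => (w t - z) ^ (m + 1))
          (((m + 1 : ℕ) : ℂ) * (w t - x) ^ m * -1) (x : ℂ) :=
        ((hasDerivAt_id (x : ℂ)).const_sub (w t)).pow (m + 1)
      convert! (hasDerivAt_const (x : ℂ) (φ t)).fun_div h2 (pow_ne_zero _ hne) using 1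
      push_cast
      field_simp
      ring
    exact h1.comp_ofReal

theorem hasDerivAt_rectIntegral {R b : ℝ} (hb : 0 < b) {G : ℂ → ℂ}
    (hG : ContinuousOn G (rectBoundary R b)) {x₀ : ℝ} (hx : |x₀| < R) (m : ℕ) :
    HasDerivAt (fun x : ℝ => rectIntegral R b (fun z => G z / (z - x) ^ (m + 1)))
      ((m + 1) * rectIntegral R b (fun z => G z / (z - x₀) ^ (m + 2))) x₀ := by
  have hR : 0 ≤ R := (abs_nonneg _).trans hx.le
  have hR' : -R ≤ R := by linarith
  have hb' : -b ≤ b := by linarith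
  have hxre : |(x₀ : ℂ).re| < R := by simpa using hx
  have hxim : |(x₀ : ℂ).im| < b := by simpa using hb
  have h1 := hasDerivAt_integral_div_sub_pow hR' (continuousOn_bottom hb.le hG)
    (w := fun t => t - b * I) (by fun_prop)
    (fun t ht => ne_of_mem_rectBoundary (bottom_mem_rectBoundary hb.le ht) hxre hxim) m
  have h2 := hasDerivAt_integral_div_sub_pow hR' (continuousOn_top hb.le hG)
    (w := fun t => t + b * I) (by fun_prop)
    (fun t ht => ne_of_mem_rectBoundary (top_mem_rectBoundary hb.le ht) hxre hxim) m
  have h3 := hasDerivAt_integral_div_sub_pow hb' (continuousOn_right hR hG)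
    (w := fun t => R + t * I) (by fun_prop)
    (fun t ht => ne_of_mem_rectBoundary (right_mem_rectBoundary hR ht) hxre hxim) m
  have h4 := hasDerivAt_integral_div_sub_pow hb' (continuousOn_left hR hG)
    (w := fun t => -R + t * I) (by fun_prop)
    (fun t ht => ne_of_mem_rectBoundary (left_mem_rectBoundary hR ht) hxre hxim) m
  refine (((h1.sub h2).add (h3.const_mul I)).sub (h4.const_mul I)).congr_deriv ?_
  unfold rectIntegral
  ring

theorem hasDerivAt_csin_ofReal (h x : ℝ) :
    HasDerivAt (fun x : ℝ => csin h x)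
      (Complex.cos (Real.pi * (x / h)) * (Real.pi * (1 / h))) x :=
  HasDerivAt.comp_ofReal (e := csin h)
    ((((hasDerivAt_id (x : ℂ)).div_const (h : ℂ)).const_mul (Real.pi : ℂ)).csin)

theorem hasDerivAt_ccos_ofReal (h x : ℝ) :
    HasDerivAt (fun x : ℝ => Complex.cos (Real.pi * (x / h)) * (Real.pi * (1 / h)))
      (-csin h x * (Real.pi * (1 / h)) * (Real.pi * (1 / h))) x :=
  HasDerivAt.comp_ofReal (e := fun z : ℂ => Complex.cos (Real.pi * (z / h)) * (Real.pi * (1 / h)))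
    ((((hasDerivAt_id (x : ℂ)).div_const (h : ℂ)).const_mul (Real.pi : ℂ)).ccos.mul_const _)

theorem norm_csin_ofReal_le (h x : ℝ) : ‖csin h x‖ ≤ 1 := by
  have : csin h x = ((Real.sin (Real.pi * (x / h)) : ℝ) : ℂ) := by
    rw [csin]; push_cast; rfl
  rw [this, norm_real]
  exact Real.abs_sin_le_one _

theorem norm_ccos_ofReal_le (h x : ℝ) : ‖Complex.cos (Real.pi * (x / h))‖ ≤ 1 := by
  have : Complex.cos (Real.pi * (x / h)) = ((Real.cos (Real.pi * (x / h)) : ℝ) : ℂ) := by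
    push_cast; rfl
  rw [this, norm_real]
  exact Real.abs_cos_le_one _

section
variable {h : ℝ}

theorem continuousOn_div_csin (hh : 0 < h) (K : ℕ) {d b : ℝ} (hb : 0 < b) (hbd : b < d)
    {g : ℂ → ℂ} (hg : AnalyticOnNhd ℂ g (strip d)) :
    ContinuousOn (fun z => g z / csin h z) (rectBoundary ((K + 1 / 2) * h) b) := by
  refine ContinuousOn.div (hg.continuousOn.mono ?_)
    (differentiable_csin h).continuous.continuousOn fun z hz =>
      csin_ne_zero_of_mem_rectBoundary hh K hb hz
  intro z hz
  rcases hz with h1 | h1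
  · exact lt_of_le_of_lt h1.2 hbd
  · exact lt_of_eq_of_lt h1.1 hbd

/-- The product rule for the sine times the Cauchy integral `q 0`, with `q m` having derivative `(m
+ 1) * q (m + 1)`. Each derivative of the sine costs `π / h`; the common factor `2 * (1 + 1 / h) ^
2` dominates all three coefficients. -/
theorem norm_iteratedDeriv_error_le (hh : 0 < h) (K : ℕ) {d b : ℝ} (hb : 0 < b) (hbd : b < d)
    {g : ℂ → ℂ} (hg : AnalyticOnNhd ℂ g (strip d)) {x : ℝ} (hx : |x| < (K + 1 / 2) * h)
    (hx0 : csin h x ≠ 0) :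
    ‖iteratedDeriv 2 (fun t : ℝ => g t - truncSinc g K K h t) x‖ ≤
      2 * (1 + 1 / h) ^ 2 * ∑ m ∈ Finset.range 3,
        ‖rectIntegral ((K + 1 / 2) * h) b (fun z => g z / csin h z / (z - x) ^ (m + 1))‖ := by
  set R : ℝ := (K + 1 / 2) * h with hR
  have hG := continuousOn_div_csin hh K hb hbd hg
  let q : ℕ → ℝ → ℂ := fun m x => rectIntegral R b (fun z => g z / csin h z / (z - x) ^ (m + 1))
  have hq : ∀ (m : ℕ) (y : ℝ), |y| < R → HasDerivAt (q m) ((m + 1) * q (m + 1) y) y :=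
    fun m y hy => hasDerivAt_rectIntegral hb hG hy m
  set P : ℂ := Real.pi * (1 / h) with hP
  let c : ℝ → ℂ := fun x => Complex.cos (Real.pi * (x / h))
  set κ : ℂ := (2 * Real.pi * I)⁻¹ with hκ
  let D : ℝ → ℂ := fun y => κ * (c y * P * q 0 y + csin h y * q 1 y)
  have hcs : Continuous fun t : ℝ => csin h t :=
    (differentiable_csin h).continuous.comp continuous_ofReal
  have hopen : IsOpen {y : ℝ | |y| < R ∧ csin h y ≠ 0} :=
    (isOpen_lt continuous_abs continuous_const).inter (isOpen_ne.preimage hcs)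
  have h1 : ∀ y ∈ {y : ℝ | |y| < R ∧ csin h y ≠ 0},
      HasDerivAt (fun t : ℝ => g t - truncSinc g K K h t) (D y) y := by
    intro y hy
    have hd : HasDerivAt (fun t : ℝ => κ * (csin h t * q 0 t)) (D y) y := by
      have := ((hasDerivAt_csin_ofReal h y).mul (hq 0 y hy.1)).const_mul κ
      refine this.congr_deriv ?_
      simp only [D, c, hP]
      push_cast
      ring
    refine hd.congr_of_eventuallyEq ?_
    filter_upwards [hopen.mem_nhds hy] with t ht
    rw [sub_truncSinc_eq hh K hb hbd hg ht.1 ht.2]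
    simp only [q, zero_add, pow_one]
    rw [div_eq_mul_inv]
    ring
  have h2 : HasDerivAt D (κ * (-csin h x * P * P * q 0 x + 2 * (c x * P * q 1 x) +
      csin h x * (2 * q 2 x))) x := by
    have := (((hasDerivAt_ccos_ofReal h x).mul (hq 0 x hx)).add
      ((hasDerivAt_csin_ofReal h x).mul (hq 1 x hx))).const_mul κ
    refine this.congr_deriv ?_
    simp only [c, hP]
    push_cast
    ring
  have h3 : iteratedDeriv 2 (fun t : ℝ => g t - truncSinc g K K h t) x =
      κ * (-csin h x * P * P * q 0 x + 2 * (c x * P * q 1 x) + csin h x * (2 * q 2 x)) := by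
    rw [iteratedDeriv_succ, iteratedDeriv_one, ← h2.deriv]
    refine EventuallyEq.deriv_eq ?_
    filter_upwards [hopen.mem_nhds ⟨hx, hx0⟩] with y hy using (h1 y hy).deriv
  rw [h3, norm_mul]
  have hpi := Real.pi_pos
  have nP : ‖P‖ = Real.pi / h := by
    rw [hP, norm_mul, norm_div, norm_one, norm_real, norm_real, Real.norm_of_nonneg hpi.le,
      Real.norm_of_nonneg hh.le]
    ring
  have nκ : ‖κ‖ = 1 / (2 * Real.pi) := by
    rw [hκ, norm_inv, norm_mul, norm_mul, norm_I, norm_real, Real.norm_of_nonneg hpi.le,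
      Complex.norm_ofNat]
    ring
  have b0 : ‖-csin h x * P * P * q 0 x‖ ≤ (Real.pi / h) ^ 2 * ‖q 0 x‖ := by
    rw [norm_mul, norm_mul, norm_mul, norm_neg, nP]
    have := norm_csin_ofReal_le h x
    calc _ ≤ 1 * (Real.pi / h) * (Real.pi / h) * ‖q 0 x‖ := by gcongr
      _ = _ := by ring
  have b1 : ‖2 * (c x * P * q 1 x)‖ ≤ 2 * (Real.pi / h) * ‖q 1 x‖ := by
    rw [norm_mul, norm_mul, norm_mul, nP, Complex.norm_ofNat]
    have : ‖c x‖ ≤ 1 := norm_ccos_ofReal_le h x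
    calc _ ≤ 2 * (1 * (Real.pi / h) * ‖q 1 x‖) := by gcongr
      _ = _ := by ring
  have b2 : ‖csin h x * (2 * q 2 x)‖ ≤ 2 * ‖q 2 x‖ := by
    rw [norm_mul, norm_mul, Complex.norm_ofNat]
    have := norm_csin_ofReal_le h x
    calc _ ≤ 1 * (2 * ‖q 2 x‖) := by gcongr
      _ = _ := by ring
  have hsum : ∑ m ∈ Finset.range 3,
      ‖rectIntegral R b (fun z => g z / csin h z / (z - x) ^ (m + 1))‖ =
      ‖q 0 x‖ + ‖q 1 x‖ + ‖q 2 x‖ := by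
    simp [Finset.sum_range_succ, q]
  rw [hsum, nκ]
  have hi : 0 < 1 / h := by positivity
  have hpi4 := Real.pi_le_four
  have hpi3 := Real.pi_gt_three
  have k0 : 1 / (2 * Real.pi) * (Real.pi / h) ^ 2 ≤ 2 * (1 + 1 / h) ^ 2 := by
    have : 1 / (2 * Real.pi) * (Real.pi / h) ^ 2 = Real.pi / 2 * (1 / h) ^ 2 := by field_simp
    rw [this]
    nlinarith
  have k1 : 1 / (2 * Real.pi) * (2 * (Real.pi / h)) ≤ 2 * (1 + 1 / h) ^ 2 := by
    have : 1 / (2 * Real.pi) * (2 * (Real.pi / h)) = 1 / h := by field_simp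
    rw [this]
    nlinarith
  have k2 : 1 / (2 * Real.pi) * 2 ≤ 2 * (1 + 1 / h) ^ 2 := by
    have : 1 / (2 * Real.pi) * 2 ≤ 1 := by
      rw [div_mul_eq_mul_div, div_le_one (by positivity)]; linarith
    nlinarith
  calc 1 / (2 * Real.pi) * ‖_‖ ≤ 1 / (2 * Real.pi) * ((Real.pi / h) ^ 2 * ‖q 0 x‖ +
        2 * (Real.pi / h) * ‖q 1 x‖ + 2 * ‖q 2 x‖) := by
        gcongr
        exact (norm_add₃_le).trans (by gcongr)
    _ = (1 / (2 * Real.pi) * (Real.pi / h) ^ 2) * ‖q 0 x‖ +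
        (1 / (2 * Real.pi) * (2 * (Real.pi / h))) * ‖q 1 x‖ +
        (1 / (2 * Real.pi) * 2) * ‖q 2 x‖ := by ring
    _ ≤ 2 * (1 + 1 / h) ^ 2 * ‖q 0 x‖ + 2 * (1 + 1 / h) ^ 2 * ‖q 1 x‖ +
        2 * (1 + 1 / h) ^ 2 * ‖q 2 x‖ := by gcongr
    _ = _ := by ring

end

end

/-! ### Estimates on the four sides -/

section

open Set Complex

theorem normSq_sin_add_mul_I (u v : ℝ) :
    ‖Complex.sin (u + v * I)‖ ^ 2 = Real.sin u ^ 2 + Real.sinh v ^ 2 := by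
  have : Complex.sin (u + v * I) = ((Real.sin u * Real.cosh v : ℝ) : ℂ) +
      ((Real.cos u * Real.sinh v : ℝ) : ℂ) * I := by
    rw [Complex.sin_add_mul_I]; push_cast; ring
  rw [this, ← Complex.normSq_eq_norm_sq, Complex.normSq_add_mul_I, mul_pow, mul_pow, Real.cosh_sq,
    Real.cos_sq']
  ring

theorem sinh_le_norm_csin (h b t : ℝ) :
    Real.sinh (Real.pi * b / h) ≤ ‖csin h (t + b * I)‖ := by
  refine le_of_sq_le_sq ?_ (norm_nonneg _)
  have : csin h (t + b * I) = Complex.sin ((Real.pi * t / h : ℝ) + (Real.pi * b / h : ℝ) * I) := by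
    rw [csin]; push_cast; ring_nf
  rw [this, normSq_sin_add_mul_I]
  nlinarith [sq_nonneg (Real.sin (Real.pi * t / h))]

theorem sinh_le_norm_csin_neg (h b t : ℝ) :
    Real.sinh (Real.pi * b / h) ≤ ‖csin h (t - b * I)‖ := by
  have h1 := sinh_le_norm_csin h b (-t)
  have : csin h (t - b * I) = -csin h ((-t : ℝ) + b * I) := by
    rw [csin, csin, ← Complex.sin_neg]
    congr 1
    push_cast; ring
  rwa [this, norm_neg]

/-- Midway between nodes the real part of the argument is an odd multiple of `π / 2`, so the squared
sine of it is already `1`. -/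
theorem one_le_norm_csin {h : ℝ} (hh : 0 < h) (K : ℕ) (y : ℝ) :
    1 ≤ ‖csin h (((K + 1 / 2) * h : ℝ) + y * I)‖ := by
  have hh' : (h : ℂ) ≠ 0 := by exact_mod_cast hh.ne'
  have : csin h (((K + 1 / 2) * h : ℝ) + y * I) =
      Complex.sin ((K * Real.pi + Real.pi / 2 : ℝ) + (Real.pi * y / h : ℝ) * I) := by
    rw [csin]; push_cast; congr 1; field_simp
  refine (one_le_sq_iff₀ (norm_nonneg _)).1 ?_
  rw [this, normSq_sin_add_mul_I, Real.sin_add_pi_div_two]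
  have := Real.sin_sq_add_cos_sq (K * Real.pi)
  rw [Real.sin_nat_mul_pi] at this
  nlinarith [sq_nonneg (Real.sinh (Real.pi * y / h))]

theorem one_le_norm_csin_neg {h : ℝ} (hh : 0 < h) (K : ℕ) (y : ℝ) :
    1 ≤ ‖csin h (-((K + 1 / 2) * h : ℝ) + y * I)‖ := by
  have h1 := one_le_norm_csin hh K (-y)
  have : csin h (-((K + 1 / 2) * h : ℝ) + y * I) =
      -csin h (((K + 1 / 2) * h : ℝ) + (-y : ℝ) * I) := by
    rw [csin, csin, ← Complex.sin_neg]
    congr 1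
    push_cast; ring
  rwa [this, norm_neg]

/-- A side integral that is far from `x` is at most the integral of `|φ|`. -/
theorem enorm_integral_div_sub_pow_le {u v : ℝ} (huv : u ≤ v) {φ w : ℝ → ℂ} {ψ : ℝ → ℂ} {x : ℝ}
    (hw : ∀ t, 1 ≤ ‖w t - x‖) (hφ : ∀ t, ‖φ t‖ ≤ ‖ψ t‖) (m : ℕ) :
    ‖∫ t in u..v, φ t / (w t - x) ^ m‖ₑ ≤ ∫⁻ t in Ioo u v, ‖ψ t‖ₑ := by
  rw [intervalIntegral.integral_of_le huv, integral_Ioc_eq_integral_Ioo]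
  refine (enorm_integral_le_lintegral_enorm _).trans (lintegral_mono fun t => ?_)
  rw [enorm_le_iff_norm_le, norm_div, norm_pow]
  exact (div_le_self (norm_nonneg _) (one_le_pow₀ (hw t))).trans (hφ t)

theorem memLp_indicator_of_continuousOn {u v : ℝ} {φ : ℝ → ℂ} (hφ : ContinuousOn φ (Icc u v)) :
    Integrable ((Ioc u v).indicator φ) ∧ MemLp ((Ioc u v).indicator φ) 2 := by
  have h1 : IntegrableOn φ (Ioc u v) := (hφ.integrableOn_Icc).mono_set Ioc_subset_Icc_self
  refine ⟨h1.integrable_indicator measurableSet_Ioc, ?_⟩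
  rw [memLp_indicator_iff_restrict measurableSet_Ioc]
  obtain ⟨A, hA⟩ := isCompact_Icc.exists_bound_of_continuousOn hφ
  refine MemLp.of_bound h1.1 A ?_
  filter_upwards [ae_restrict_mem measurableSet_Ioc] with t ht using hA t (Ioc_subset_Icc_self ht)

theorem integral_indicator_div {u v : ℝ} (huv : u ≤ v) (φ w : ℝ → ℂ) :
    ∫ t, (Ioc u v).indicator φ t / w t = ∫ t in u..v, φ t / w t := by
  rw [intervalIntegral.integral_of_le huv, ← integral_indicator measurableSet_Ioc]
  congr 1
  ext t
  by_cases ht : t ∈ Ioc u v <;> simp [ht]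

theorem eLpNorm_indicator_le {u v s : ℝ} {φ ψ : ℝ → ℂ}
    (hφ : ∀ t, ‖φ t‖ ≤ ‖ψ t‖ / s) :
    eLpNorm ((Ioc u v).indicator φ) 2 volume ≤
      ENNReal.ofReal (1 / s) * (∫⁻ t in Ioo u v, ‖ψ t‖ₑ ^ 2) ^ (1 / 2 : ℝ) := by
  rw [eLpNorm_indicator_eq_eLpNorm_restrict measurableSet_Ioc]
  have e : eLpNorm ψ 2 (volume.restrict (Ioc u v)) =
      (∫⁻ t in Ioo u v, ‖ψ t‖ₑ ^ 2) ^ (1 / 2 : ℝ) := by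
    rw [eLpNorm_eq_lintegral_rpow_enorm_toReal (by norm_num) (by norm_num),
      restrict_Ioo_eq_restrict_Ioc]
    simp
  rw [← e]
  refine eLpNorm_le_mul_eLpNorm_of_ae_le_mul (Eventually.of_forall fun t => ?_) 2
  rw [one_div_mul_eq_div]
  exact hφ t

theorem aestronglyMeasurable_cauchy {f : ℝ → ℂ} (hf : AEStronglyMeasurable f) (p : ℂ) (m : ℕ) :
    AEStronglyMeasurable (fun x : ℝ => ∫ t : ℝ, f t / ((t : ℂ) + p - x) ^ m) volume := by
  have : AEStronglyMeasurable
      (fun q : ℝ × ℝ => f q.2 * (((q.2 : ℂ) + p - q.1) ^ m)⁻¹) (volume.prod volume) := by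
    refine (hf.comp_snd).mul (Measurable.aestronglyMeasurable ?_)
    fun_prop
  simpa only [div_eq_mul_inv] using this.integral_prod_right'

section
variable {h : ℝ}

/-- The contour integral is bounded in `L²(-T, T)` by the boundary norm of `g`. -/
theorem eLpNorm_error_le (hh : 0 < h) (K : ℕ) {d b : ℝ} (hb : 0 < b) (hbd : b < d)
    {g : ℂ → ℂ} (hg : AnalyticOnNhd ℂ g (strip d)) {T : ℝ} (hT : 0 < T)
    (hTR : T + 1 ≤ (K + 1 / 2) * h) {C δ₁ δ₂ : ENNReal}
    (hC₁ : (∫⁻ t in Ioo (-((K + 1 / 2) * h)) ((K + 1 / 2) * h), ‖g (t - b * I)‖ₑ ^ 2) ^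
      (1 / 2 : ℝ) ≤ C)
    (hC₂ : (∫⁻ t in Ioo (-((K + 1 / 2) * h)) ((K + 1 / 2) * h), ‖g (t + b * I)‖ₑ ^ 2) ^
      (1 / 2 : ℝ) ≤ C)
    (hδ₁ : ∫⁻ y in Ioo (-b) b, ‖g (((K + 1 / 2) * h : ℝ) + y * I)‖ₑ ≤ δ₁)
    (hδ₂ : ∫⁻ y in Ioo (-b) b, ‖g (-((K + 1 / 2) * h : ℝ) + y * I)‖ₑ ≤ δ₂) :
    eLpNorm (iteratedDeriv 2 (fun t : ℝ => g t - truncSinc g K K h t)) 2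
        (volume.restrict (Ioo (-T) T)) ≤
      ENNReal.ofReal (2 * (1 + 1 / h) ^ 2) * ∑ m ∈ Finset.range 3,
        (2 * (ENNReal.ofReal (2 * Real.pi / b ^ m) *
          (ENNReal.ofReal (1 / Real.sinh (Real.pi * b / h)) * C)) +
          (δ₁ + δ₂) * ENNReal.ofReal (2 * T) ^ (1 / 2 : ℝ)) := by
  set R : ℝ := (K + 1 / 2) * h with hR
  have hR0 : 0 < R := by positivity
  have hR' : -R ≤ R := by linarith
  have hb' : -b ≤ b := by linarith
  have hG := continuousOn_div_csin hh K hb hbd hg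
  set s : ℝ := Real.sinh (Real.pi * b / h) with hs
  have hs0 : 0 < s := Real.sinh_pos_iff.2 (by have := Real.pi_pos; positivity)
  let fl : ℝ → ℂ := (Ioc (-R) R).indicator fun t => g (t - b * I) / csin h (t - b * I)
  let fu : ℝ → ℂ := (Ioc (-R) R).indicator fun t => g (t + b * I) / csin h (t + b * I)
  have hfl := memLp_indicator_of_continuousOn (continuousOn_bottom hb.le hG)
  have hfu := memLp_indicator_of_continuousOn (continuousOn_top hb.le hG)
  have nfl : eLpNorm fl 2 volume ≤ ENNReal.ofReal (1 / s) * C := by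
    refine (eLpNorm_indicator_le (ψ := fun t : ℝ => g (t - b * I)) fun t => ?_).trans
      (by gcongr)
    rw [norm_div]
    gcongr
    exact sinh_le_norm_csin_neg h b t
  have nfu : eLpNorm fu 2 volume ≤ ENNReal.ofReal (1 / s) * C := by
    refine (eLpNorm_indicator_le (ψ := fun t : ℝ => g (t + b * I)) fun t => ?_).trans
      (by gcongr)
    rw [norm_div]
    gcongr
    exact sinh_le_norm_csin h b t
  let Jl : ℕ → ℝ → ℂ := fun m x => ∫ t : ℝ, fl t / ((t : ℂ) - b * I - x) ^ (m + 1)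
  let Ju : ℕ → ℝ → ℂ := fun m x => ∫ t : ℝ, fu t / ((t : ℂ) + b * I - x) ^ (m + 1)
  have mJl : ∀ m, AEStronglyMeasurable (Jl m) volume := fun m =>
    aestronglyMeasurable_cauchy hfl.1.1 (-(b * I)) (m + 1)
  have mJu : ∀ m, AEStronglyMeasurable (Ju m) volume := fun m =>
    aestronglyMeasurable_cauchy hfu.1.1 (b * I) (m + 1)
  set μ := (volume : Measure ℝ).restrict (Ioo (-T) T) with hμ
  -- The horizontal sides go into `L²` through the Cauchy kernel bounds. For `|x| < T` the vertical
  -- sides are at distance at least `1`, so they contribute only constants, whose norm on the window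
  -- carries the factor `√(2T)`.
  let Φ : ℕ → ℝ → ENNReal := fun m x => ‖Jl m x‖ₑ + ‖Ju m x‖ₑ + (δ₁ + δ₂)
  have hq : ∀ m, ∀ x ∈ Ioo (-T) T,
      ‖rectIntegral R b (fun z => g z / csin h z / (z - x) ^ (m + 1))‖ₑ ≤ Φ m x := by
    intro m x hx
    have e1 : Jl m x = ∫ t in (-R)..R, g (t - b * I) / csin h (t - b * I) /
        ((t : ℂ) - b * I - x) ^ (m + 1) := integral_indicator_div hR' _ _
    have e2 : Ju m x = ∫ t in (-R)..R, g (t + b * I) / csin h (t + b * I) /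
        ((t : ℂ) + b * I - x) ^ (m + 1) := integral_indicator_div hR' _ _
    have b1 := (enorm_integral_div_sub_pow_le hb' (x := x)
      (φ := fun y => g (R + y * I) / csin h (R + y * I)) (w := fun y => R + y * I)
      (ψ := fun y => g (R + y * I)) (fun y => by
        refine le_trans ?_ (abs_re_le_norm _)
        simp only [sub_re, add_re, ofReal_re, mul_re, I_re, mul_zero, ofReal_im, I_im, mul_one,
          sub_self, add_zero]
        exact le_trans (by linarith [hx.2]) (le_abs_self _)) (fun y => by
        rw [norm_div]
        exact div_le_self (norm_nonneg _) (one_le_norm_csin hh K y)) (m + 1)).trans hδ₁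
    have b2 := (enorm_integral_div_sub_pow_le hb' (x := x)
      (φ := fun y => g (-R + y * I) / csin h (-R + y * I)) (w := fun y => -R + y * I)
      (ψ := fun y => g (-R + y * I)) (fun y => by
        refine le_trans ?_ (abs_re_le_norm _)
        simp only [sub_re, add_re, neg_re, ofReal_re, mul_re, I_re, mul_zero, ofReal_im, I_im,
          mul_one, sub_self, add_zero]
        exact le_trans (by linarith [hx.1]) (neg_le_abs _)) (fun y => by
        rw [norm_div]
        exact div_le_self (norm_nonneg _) (one_le_norm_csin_neg hh K y)) (m + 1)).trans hδ₂
    rw [rectIntegral, ← e1, ← e2]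
    refine (enorm_sub_le).trans ?_
    simp only [Φ, ← add_assoc]
    rw [enorm_mul, enorm_eq_nnnorm I, nnnorm_I, ENNReal.coe_one, one_mul]
    refine add_le_add ?_ b2
    refine (enorm_add_le _ _).trans ?_
    rw [enorm_mul, enorm_eq_nnnorm I, nnnorm_I, ENNReal.coe_one, one_mul]
    exact add_le_add enorm_sub_le b1
  have hae : ∀ᵐ x ∂μ, ‖iteratedDeriv 2 (fun t : ℝ => g t - truncSinc g K K h t) x‖ₑ ≤
      (2 * (1 + 1 / h) ^ 2).toNNReal * ‖∑ m ∈ Finset.range 3, Φ m x‖ₑ := by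
    -- The contour formula divides by the sine, so the countable set of nodes is discarded.
    have hnull : ∀ᵐ x : ℝ ∂μ, csin h x ≠ 0 := by
      refine ae_restrict_of_ae (Countable.ae_notMem (s := range fun k : ℤ => k * h)
        (countable_range _) volume |>.mono ?_)
      intro x hx h0
      obtain ⟨k, hk⟩ := (csin_eq_zero_iff hh.ne').1 h0
      exact hx ⟨k, by exact_mod_cast hk.symm⟩
    filter_upwards [hnull, ae_restrict_mem measurableSet_Ioo] with x hx0 hx
    have hxR : |x| < R := (abs_lt.2 hx).trans (by linarith)
    have := norm_iteratedDeriv_error_le hh K hb hbd hg hxR hx0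
    rw [enorm_eq_self, ← ofReal_norm, ← ENNReal.ofReal]
    refine (ENNReal.ofReal_le_ofReal this).trans ?_
    rw [ENNReal.ofReal_mul (by positivity), ENNReal.ofReal_sum_of_nonneg fun _ _ => norm_nonneg _]
    gcongr with m
    rw [ofReal_norm]
    exact hq m x hx
  have hΦ : ∀ m, eLpNorm (Φ m) 2 μ ≤ 2 * (ENNReal.ofReal (2 * Real.pi / b ^ m) *
      (ENNReal.ofReal (1 / s) * C)) + (δ₁ + δ₂) * ENNReal.ofReal (2 * T) ^ (1 / 2 : ℝ) := by
    intro m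
    have a1 : eLpNorm (fun x => ‖Jl m x‖ₑ) 2 μ ≤ ENNReal.ofReal (2 * Real.pi / b ^ m) *
        (ENNReal.ofReal (1 / s) * C) := by
      rw [eLpNorm_enorm]
      refine (eLpNorm_mono_measure _ Measure.restrict_le_self).trans ?_
      exact (eLpNorm_cauchy_lower_le hfl.1 hfl.2 hb m).trans (by gcongr)
    have a2 : eLpNorm (fun x => ‖Ju m x‖ₑ) 2 μ ≤ ENNReal.ofReal (2 * Real.pi / b ^ m) *
        (ENNReal.ofReal (1 / s) * C) := by
      rw [eLpNorm_enorm]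
      refine (eLpNorm_mono_measure _ Measure.restrict_le_self).trans ?_
      exact (eLpNorm_cauchy_upper_le hfu.1 hfu.2 hb m).trans (by gcongr)
    have a3 : eLpNorm (fun _ : ℝ => δ₁ + δ₂) 2 μ ≤
        (δ₁ + δ₂) * ENNReal.ofReal (2 * T) ^ (1 / 2 : ℝ) := by
      rw [eLpNorm_const' _ (by norm_num) (by norm_num), hμ, Measure.restrict_apply_univ,
        Real.volume_Ioo, enorm_eq_self, sub_neg_eq_add, ← two_mul]
      norm_num
    have m1 : AEStronglyMeasurable (fun x => ‖Jl m x‖ₑ) μ :=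
      ((mJl m).enorm.aestronglyMeasurable).restrict
    have m2 : AEStronglyMeasurable (fun x => ‖Ju m x‖ₑ) μ :=
      ((mJu m).enorm.aestronglyMeasurable).restrict
    refine (eLpNorm_add_le (m1.add m2) aestronglyMeasurable_const (by norm_num)).trans ?_
    rw [two_mul]
    refine add_le_add ((eLpNorm_add_le m1 m2 (by norm_num)).trans (add_le_add a1 a2)) a3
  have hΦm : ∀ m, AEStronglyMeasurable (Φ m) μ := fun m =>
    ((((mJl m).enorm.add (mJu m).enorm).add aemeasurable_const).aestronglyMeasurable).restrict
  refine (eLpNorm_le_nnreal_smul_eLpNorm_of_ae_le_mul' hae 2).trans ?_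
  rw [ENNReal.smul_def, smul_eq_mul]
  refine mul_le_mul_right ?_ _
  have e : (fun x => ∑ m ∈ Finset.range 3, Φ m x) = ∑ m ∈ Finset.range 3, Φ m := by
    ext x; simp
  rw [e]
  exact (eLpNorm_sum_le (fun m _ => hΦm m) (by norm_num)).trans
    (Finset.sum_le_sum fun m _ => hΦ m)

end

end

/-! ### Second derivatives of the Sinc functions -/

section

open Set Complex

/-- The second derivative of `sin t / t`. -/
def sincSecond (t : ℝ) : ℂ := deriv (deriv csinc) t

theorem differentiable_deriv_csinc : Differentiable ℂ (deriv csinc) :=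
  ((differentiable_csinc.contDiff (n := 2)).iterate_deriv' 1 1).differentiable (by norm_num)

theorem differentiable_deriv_deriv_csinc : Differentiable ℂ (deriv (deriv csinc)) :=
  ((differentiable_deriv_csinc.contDiff (n := 2)).iterate_deriv' 1 1).differentiable (by norm_num)

theorem continuous_sincSecond : Continuous sincSecond :=
  differentiable_deriv_deriv_csinc.continuous.comp continuous_ofReal

theorem mul_csinc (z : ℂ) : z * csinc z = Complex.sin z := by
  by_cases hz : z = 0
  · simp [hz]
  · rw [csinc_of_ne_zero hz, mul_div_cancel₀ _ hz]

theorem csinc_add_mul_deriv (z : ℂ) : csinc z + z * deriv csinc z = Complex.cos z := by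
  have h1 : HasDerivAt (fun z => z * csinc z) (1 * csinc z + z * deriv csinc z) z :=
    (hasDerivAt_id z).mul (differentiable_csinc z).hasDerivAt
  rw [funext mul_csinc] at h1
  rw [← one_mul (csinc z)]
  exact h1.unique (hasDerivAt_sin z)

theorem two_mul_deriv_csinc_add (z : ℂ) :
    2 * deriv csinc z + z * deriv (deriv csinc) z = -Complex.sin z := by
  have h1 : HasDerivAt (fun z => csinc z + z * deriv csinc z)
      (deriv csinc z + (1 * deriv csinc z + z * deriv (deriv csinc) z)) z :=
    (differentiable_csinc z).hasDerivAt.add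
      ((hasDerivAt_id z).mul (differentiable_deriv_csinc z).hasDerivAt)
  rw [funext csinc_add_mul_deriv] at h1
  rw [← h1.unique (hasDerivAt_cos z)]
  ring

/-- Differentiating `z * csinc z = sin z` twice expresses `t * sincSecond t` through bounded
functions. This decay is what puts `sincSecond` in `L²`. -/
theorem norm_sincSecond_le {t : ℝ} (ht : 1 ≤ |t|) : ‖sincSecond t‖ ≤ 5 / |t| := by
  have ht0 : 0 < |t| := by linarith
  have nt : ‖(t : ℂ)‖ = |t| := by rw [norm_real, Real.norm_eq_abs]
  have ns : ‖Complex.sin t‖ ≤ 1 := by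
    rw [← ofReal_sin, norm_real]; exact Real.abs_sin_le_one t
  have nc : ‖Complex.cos t‖ ≤ 1 := by
    rw [← ofReal_cos, norm_real]; exact Real.abs_cos_le_one t
  have n0 : ‖csinc t‖ ≤ 1 := by
    rw [csinc_ofReal, norm_real]; exact Real.abs_sinc_le_one t
  have n1 : ‖deriv csinc t‖ ≤ 2 := by
    have : (t : ℂ) * deriv csinc t = Complex.cos t - csinc t := by
      rw [← csinc_add_mul_deriv]; ring
    have h2 : |t| * ‖deriv csinc t‖ ≤ 2 := by
      rw [← nt, ← norm_mul, this]
      exact (norm_sub_le _ _).trans (by linarith)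
    nlinarith [norm_nonneg (deriv csinc t)]
  have : (t : ℂ) * sincSecond t = -Complex.sin t - 2 * deriv csinc t := by
    rw [← two_mul_deriv_csinc_add, sincSecond]; ring
  rw [le_div_iff₀ ht0, mul_comm, ← nt, ← norm_mul, this]
  refine (norm_sub_le _ _).trans ?_
  rw [norm_neg, norm_mul, Complex.norm_ofNat]
  linarith

theorem memLp_sincSecond : MemLp sincSecond 2 volume := by
  obtain ⟨A, hA⟩ := (isCompact_Icc (a := (-1 : ℝ)) (b := 1)).exists_bound_of_continuousOn
    continuous_sincSecond.continuousOn
  rw [memLp_two_iff_integrable_sq_norm continuous_sincSecond.aestronglyMeasurable]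
  refine (integrable_inv_one_add_sq.const_mul (2 * A ^ 2 + 50)).mono'
    (by have := continuous_sincSecond; fun_prop) (Eventually.of_forall fun t => ?_)
  rw [Real.norm_of_nonneg (by positivity), ← div_eq_mul_inv, le_div_iff₀ (by positivity)]
  rcases le_or_gt 1 |t| with ht | ht
  · have h1 := norm_sincSecond_le ht
    rw [le_div_iff₀ (by linarith)] at h1
    have h2 : (‖sincSecond t‖ * |t|) ^ 2 ≤ 25 := by
      have : 0 ≤ ‖sincSecond t‖ * |t| := by positivity
      nlinarith
    rw [mul_pow, sq_abs] at h2
    have h3 : 1 ≤ t ^ 2 := by rw [← sq_abs]; nlinarith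
    nlinarith [sq_nonneg ‖sincSecond t‖, sq_nonneg A]
  · have h1 := hA t (abs_le.1 ht.le)
    have h2 : t ^ 2 ≤ 1 := by rw [← sq_abs]; nlinarith [abs_nonneg t]
    have h3 : ‖sincSecond t‖ ^ 2 ≤ A ^ 2 := by gcongr
    nlinarith [sq_nonneg ‖sincSecond t‖]

theorem contDiff_sincBasis (k : ℤ) (h : ℝ) : ContDiff ℝ 2 fun t : ℝ => (sincBasis k h t : ℂ) := by
  simp_rw [← csincBasis_ofReal]
  exact ((differentiable_csincBasis k h).contDiff.restrict_scalars ℝ).comp ofRealCLM.contDiff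

theorem iteratedDeriv_sincBasis (k : ℤ) (h x : ℝ) :
    iteratedDeriv 2 (fun t : ℝ => (sincBasis k h t : ℂ)) x =
      ((Real.pi / h) ^ 2 : ℝ) * sincSecond (Real.pi / h * (x - k * h)) := by
  have haff : ∀ t : ℝ, HasDerivAt (fun z : ℂ => Real.pi * ((z - k * h) / h))
      (Real.pi * (1 / h)) (t : ℂ) := fun t =>
    (((hasDerivAt_id (t : ℂ)).sub_const (k * h : ℂ)).div_const (h : ℂ)).const_mul _
  have h1 : deriv (fun t : ℝ => (sincBasis k h t : ℂ)) =
      fun t : ℝ => deriv csinc (Real.pi * ((t - k * h) / h)) * (Real.pi * (1 / h)) := by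
    ext t
    simp_rw [← csincBasis_ofReal]
    have := HasDerivAt.comp (t : ℂ) (differentiable_csinc _).hasDerivAt (haff t)
    exact (HasDerivAt.comp_ofReal (e := csincBasis k h) this).deriv
  have h2 : HasDerivAt
      (fun t : ℝ => deriv csinc (Real.pi * ((t - k * h) / h)) * (Real.pi * (1 / h)))
      (deriv (deriv csinc) (Real.pi * ((x - k * h) / h)) * (Real.pi * (1 / h)) *
        (Real.pi * (1 / h))) x := by
    have := (HasDerivAt.comp (x : ℂ) (differentiable_deriv_csinc _).hasDerivAt (haff x)).mul_const
      (Real.pi * (1 / h) : ℂ)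
    exact HasDerivAt.comp_ofReal
      (e := fun z : ℂ => deriv csinc (Real.pi * ((z - k * h) / h)) * (Real.pi * (1 / h))) this
  rw [iteratedDeriv_succ, iteratedDeriv_one, h1, h2.deriv, sincSecond]
  have e : ((Real.pi / h * (x - k * h) : ℝ) : ℂ) = Real.pi * ((x - k * h) / h) := by
    push_cast; ring
  rw [e]
  push_cast
  ring

/-- The chain rule gives `(π / h) ^ 2` and the change of variables `√(h / π)`; both are bounded
crudely, uniformly in `k`. -/
theorem eLpNorm_iteratedDeriv_sincBasis_le (k : ℤ) {h : ℝ} (hh : 0 < h) :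
    eLpNorm (iteratedDeriv 2 (fun t : ℝ => (sincBasis k h t : ℂ))) 2 volume ≤
      ENNReal.ofReal (16 * (1 + 1 / h) ^ 2 * (1 + h)) * eLpNorm sincSecond 2 volume := by
  have hpi := Real.pi_pos
  have ha : Real.pi / h ≠ 0 := by positivity
  have e1 : iteratedDeriv 2 (fun t : ℝ => (sincBasis k h t : ℂ)) =
      (((Real.pi / h) ^ 2 : ℝ) : ℂ) •
        ((sincSecond ∘ fun t => Real.pi / h * t) ∘ fun x => x - k * h) := by
    ext x
    simp [iteratedDeriv_sincBasis]
  have hc : Continuous (sincSecond ∘ fun t => Real.pi / h * t) :=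
    continuous_sincSecond.comp (by fun_prop)
  rw [e1, eLpNorm_const_smul, eLpNorm_comp_measurePreserving hc.aestronglyMeasurable
    (measurePreserving_sub_right volume (k * h : ℝ)),
    ← eLpNorm_map_measure continuous_sincSecond.aestronglyMeasurable (by fun_prop),
    Real.map_volume_mul_left ha, eLpNorm_smul_measure_of_ne_top (by norm_num), smul_eq_mul,
    ← mul_assoc]
  gcongr
  rw [← ofReal_norm, ENNReal.ofReal_rpow_of_nonneg (abs_nonneg _) (by simp),
    ← ENNReal.ofReal_mul (norm_nonneg _)]
  gcongr
  · rw [norm_real, Real.norm_of_nonneg (by positivity), div_pow]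
    have : Real.pi ^ 2 ≤ 16 := by nlinarith [Real.pi_le_four]
    calc Real.pi ^ 2 / h ^ 2 ≤ 16 / h ^ 2 := by gcongr
      _ = 16 * (1 / h) ^ 2 := by ring
      _ ≤ 16 * (1 + 1 / h) ^ 2 := by gcongr; linarith
  · rw [inv_div, abs_of_pos (by positivity)]
    have h1 : h / Real.pi ≤ 1 + h :=
      (div_le_self hh.le (by linarith [Real.pi_gt_three])).trans (by linarith)
    calc (h / Real.pi) ^ (1 / (2 : ENNReal)).toReal ≤ (1 + h) ^ (1 / (2 : ENNReal)).toReal := by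
          gcongr
      _ ≤ (1 + h) ^ (1 : ℝ) := by
          apply Real.rpow_le_rpow_of_exponent_le (by linarith)
          norm_num
      _ = _ := Real.rpow_one _

theorem contDiffAt_ofReal {g : ℂ → ℂ} {d : ℝ} (hd : 0 < d) (hg : AnalyticOnNhd ℂ g (strip d))
    (x : ℝ) : ContDiffAt ℝ 2 (fun t : ℝ => g t) x := by
  have h1 : ContDiffAt ℝ 2 g (x : ℂ) :=
    (hg x (by simpa [strip] using hd)).contDiffAt.restrict_scalars ℝ
  exact h1.comp x ofRealCLM.contDiff.contDiffAt

/-- The symmetric index `K` is auxiliary: it can tend to infinity, pushing the contour outward,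
while `M` and `N` stay fixed. -/
theorem secondDerivError_eq {g : ℂ → ℂ} {d : ℝ} (hd : 0 < d)
    (hg : AnalyticOnNhd ℂ g (strip d)) {M N K : ℕ} (hM : M ≤ K) (hN : N ≤ K) (h : ℝ) :
    secondDerivError g M N h = fun x =>
      iteratedDeriv 2 (fun t : ℝ => g t - truncSinc g K K h t) x +
      ∑ k ∈ Finset.Icc (-(K : ℤ)) K \ Finset.Icc (-(M : ℤ)) N, g ((k * h : ℝ) : ℂ) *
        iteratedDeriv 2 (fun t : ℝ => (sincBasis k h t : ℂ)) x := by
  ext x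
  have hterm : ∀ k : ℤ, ContDiffAt ℝ 2
      (fun t : ℝ => g ((k * h : ℝ) : ℂ) * (sincBasis k h t : ℂ)) x := fun k =>
    contDiffAt_const.mul (contDiff_sincBasis k h).contDiffAt
  have htr : ∀ M N : ℕ, iteratedDeriv 2 (truncSinc g M N h) x =
      ∑ k ∈ Finset.Icc (-(M : ℤ)) N, g ((k * h : ℝ) : ℂ) *
        iteratedDeriv 2 (fun t : ℝ => (sincBasis k h t : ℂ)) x := by
    intro M N
    have := iteratedDeriv_fun_sum (n := 2) (x := x) (I := Finset.Icc (-(M : ℤ)) N)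
      (f := fun (k : ℤ) (t : ℝ) => g ((k * h : ℝ) : ℂ) * (sincBasis k h t : ℂ))
      fun k _ => hterm k
    refine this.trans (Finset.sum_congr rfl fun k _ => ?_)
    exact iteratedDeriv_const_mul_field _ _
  have hct : ContDiffAt ℝ 2 (truncSinc g K K h) x := ContDiffAt.sum fun k _ => hterm k
  have hsub := iteratedDeriv_sub (n := 2) (contDiffAt_ofReal hd hg x) hct
  have hss : Finset.Icc (-(M : ℤ)) N ⊆ Finset.Icc (-(K : ℤ)) K :=
    Finset.Icc_subset_Icc (by omega) (by omega)
  have hsd := Finset.sum_sdiff (f := fun k : ℤ => g ((k * h : ℝ) : ℂ) *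
        iteratedDeriv 2 (fun t : ℝ => (sincBasis k h t : ℂ)) x) hss
  change _ = iteratedDeriv 2 ((fun t : ℝ => g t) - truncSinc g K K h) x + _
  rw [hsub, htr, secondDerivError, htr, ← hsd]
  ring

end

/-! ### Exhausting the strip and the real line -/

section

open Set Complex

/-- The rectangle of half-width `R` is the one with `ε = 1 / R`; near `ε = 0` the boundary norm is
below its limit plus one. -/
theorem MemB2.exists_horizontal_bound {g : ℂ → ℂ} {d : ℝ} (hg : MemB2 g d) :
    ∃ C : ENNReal, C < ⊤ ∧ ∀ᶠ R : ℝ in atTop,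
      (∫⁻ t in Ioo (-R) R, ‖g (t - (d * (1 - 1 / R) : ℝ) * I)‖ₑ ^ 2) ^ (1 / 2 : ℝ) ≤ C ∧
      (∫⁻ t in Ioo (-R) R, ‖g (t + (d * (1 - 1 / R) : ℝ) * I)‖ₑ ^ 2) ^ (1 / 2 : ℝ) ≤ C := by
  obtain ⟨L, hL, hlim⟩ := hg.finite_norm
  refine ⟨L + 1, ENNReal.add_lt_top.2 ⟨hL, ENNReal.one_lt_top⟩, ?_⟩
  have hlt : L < L + 1 := ENNReal.lt_add_right hL.ne one_ne_zero
  have h1 := (tendsto_inv_atTop_nhdsGT_zero (𝕜 := ℝ)).eventually (hlim.eventually_lt_const hlt)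
  filter_upwards [h1] with R hR
  have hR' := hR.le
  rw [boundaryIntegral, one_div R⁻¹, inv_inv] at hR'
  constructor
  · refine le_trans (ENNReal.rpow_le_rpow ?_ (by norm_num)) hR'
    refine le_trans (le_of_eq ?_) (le_add_self.trans (le_self_add.trans le_self_add))
    simp only [mk_eq_add_mul_I, one_div, ofReal_neg, neg_mul, sub_eq_add_neg]
  · refine le_trans (ENNReal.rpow_le_rpow ?_ (by norm_num)) hR'
    refine le_trans (le_of_eq ?_) (le_self_add.trans (le_self_add.trans le_self_add))
    simp only [mk_eq_add_mul_I, one_div]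

theorem eLpNorm_le_of_forall_restrict {f : ℝ → ℂ} (hf : AEStronglyMeasurable f) {B : ENNReal}
    (h : ∀ T : ℝ, 0 < T → eLpNorm f 2 (volume.restrict (Ioo (-T) T)) ≤ B) :
    eLpNorm f 2 volume ≤ B := by
  have hcov := aecover_Ioo (μ := (volume : Measure ℝ)) (l := atTop) (a := fun T : ℝ => -T)
    (b := fun T : ℝ => T) tendsto_neg_atTop_atBot tendsto_id
  have hlim := hcov.lintegral_tendsto_of_countably_generated (hf.enorm.pow_const (2 : ℝ))
  have e : ∀ μ : Measure ℝ, eLpNorm f 2 μ = (∫⁻ t, ‖f t‖ₑ ^ (2 : ℝ) ∂μ) ^ (1 / 2 : ℝ) := fun μ => by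
    rw [eLpNorm_eq_lintegral_rpow_enorm_toReal (by norm_num) (by norm_num)]
    simp
  rw [e]
  refine le_of_tendsto (hlim.ennrpow_const (1 / 2)) ?_
  filter_upwards [eventually_gt_atTop 0] with T hT
  rw [← e]
  exact h T hT

section
variable {h : ℝ}

/-- The window `T` is fixed before `K` tends to infinity, so the vertical sides vanish despite the
factor `√(2T)`. The resulting constant depends on neither `T` nor `h`. -/
theorem eventually_eLpNorm_error_le {g : ℂ → ℂ} {d : ℝ} (hd : 0 < d) (hg : MemB2 g d) :
    ∃ C₀ : ENNReal, C₀ < ⊤ ∧ ∀ h : ℝ, 0 < h → ∀ T : ℝ, 0 < T → ∀ᶠ K : ℕ in atTop,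
      eLpNorm (iteratedDeriv 2 (fun t : ℝ => g t - truncSinc g K K h t)) 2
        (volume.restrict (Ioo (-T) T)) ≤
      ENNReal.ofReal ((1 + 1 / h) ^ 2) * (ENNReal.ofReal (1 / Real.sinh (Real.pi * d / h)) * C₀) := by
  obtain ⟨C, hC, hCR⟩ := hg.exists_horizontal_bound
  refine ⟨2 * ∑ m ∈ Finset.range 3,
    (2 * (ENNReal.ofReal (2 * Real.pi / (d / 2) ^ m) * (2 * C)) + 2), ?_, ?_⟩
  · refine ENNReal.mul_lt_top (by norm_num) (ENNReal.sum_lt_top.2 fun m _ => ?_)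
    finiteness
  intro h hh T hT
  have hpi := Real.pi_pos
  set s : ℝ := 1 / Real.sinh (Real.pi * d / h) with hs
  have hs0 : 0 < s := one_div_pos.2 (Real.sinh_pos_iff.2 (by positivity))
  set W : ENNReal := ENNReal.ofReal (2 * T) ^ (1 / 2 : ℝ) with hW
  have hWt : W ≠ ⊤ := ENNReal.rpow_ne_top_of_nonneg (by norm_num) ENNReal.ofReal_ne_top
  let V : ℝ → ENNReal := fun x => ∫⁻ y in Ioo (-d) d, ‖g (⟨x, y⟩ : ℂ)‖ₑ
  have hV : Tendsto (fun R : ℝ => (V R + V (-R)) * W) atTop (𝓝 0) := by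
    have := ENNReal.Tendsto.mul_const
      (hg.tendsto_right.add (hg.tendsto_left.comp tendsto_neg_atTop_atBot)) (Or.inr hWt)
    simpa using this
  -- The vertical contribution is eventually at most `2 s`, of the size of the horizontal one.
  have hVs := hV.eventually_le_const (ENNReal.mul_pos two_ne_zero (ENNReal.ofReal_pos.2 hs0).ne')
  have hb : Tendsto (fun R : ℝ => d * (1 - 1 / R)) atTop (𝓝 d) := by
    have := ((tendsto_const_nhds (x := (1 : ℝ))).sub
      (tendsto_inv_atTop_zero (𝕜 := ℝ))).const_mul d
    simpa using this
  have hsinh : Tendsto (fun R : ℝ => 1 / Real.sinh (Real.pi * (d * (1 - 1 / R)) / h)) atTop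
      (𝓝 s) := by
    refine tendsto_const_nhds.div ?_ (Real.sinh_pos_iff.2 (by positivity)).ne'
    exact (Real.continuous_sinh.tendsto _).comp ((hb.const_mul _).div_const _)
  have hR : Tendsto (fun K : ℕ => ((K : ℝ) + 1 / 2) * h) atTop atTop :=
    (tendsto_atTop_add_const_right _ _ tendsto_natCast_atTop_atTop).atTop_mul_const hh
  have hall := hCR.and (hVs.and ((hb.eventually_const_lt (half_lt_self hd)).and
    ((hsinh.eventually_lt_const (show s < 2 * s by linarith)).and
      (eventually_ge_atTop (T + 1)))))
  filter_upwards [hR.eventually hall] with K hK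
  obtain ⟨⟨hC1, hC2⟩, hVK, hbK, hsK, hTK⟩ := hK
  set R : ℝ := ((K : ℝ) + 1 / 2) * h with hRdef
  set b : ℝ := d * (1 - 1 / R) with hbdef
  have hR0 : 0 < R := by positivity
  have hbd : b < d := by
    have : 0 < 1 / R := by positivity
    rw [hbdef]; nlinarith
  have hb0 : 0 < b := by linarith
  clear_value b
  have hsub : Ioo (-b) b ⊆ Ioo (-d) d := Ioo_subset_Ioo (by linarith) hbd.le
  have main := eLpNorm_error_le hh K hb0 hbd hg.analytic hT hTK (δ₁ := V R) (δ₂ := V (-R)) hC1 hC2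
    (by
      refine le_trans (le_of_eq ?_) (lintegral_mono_set hsub)
      simp only [mk_eq_add_mul_I, hRdef])
    (by
      refine le_trans (le_of_eq ?_) (lintegral_mono_set hsub)
      simp only [mk_eq_add_mul_I, ofReal_neg, hRdef])
  refine main.trans ?_
  rw [mul_comm (2 : ℝ), ENNReal.ofReal_mul (by positivity), mul_assoc]
  refine mul_le_mul_right ?_ _
  rw [ENNReal.ofReal_ofNat, mul_left_comm (ENNReal.ofReal s), Finset.mul_sum (a := ENNReal.ofReal s)]
  refine mul_le_mul_right (Finset.sum_le_sum fun m _ => ?_) _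
  have e1 : ENNReal.ofReal (1 / Real.sinh (Real.pi * b / h)) ≤ 2 * ENNReal.ofReal s := by
    refine (ENNReal.ofReal_le_ofReal hsK.le).trans ?_
    rw [ENNReal.ofReal_mul (by norm_num), ENNReal.ofReal_ofNat]
  have e2 : ENNReal.ofReal (2 * Real.pi / b ^ m) ≤ ENNReal.ofReal (2 * Real.pi / (d / 2) ^ m) := by
    gcongr
  calc _ ≤ 2 * (ENNReal.ofReal (2 * Real.pi / (d / 2) ^ m) * ((2 * ENNReal.ofReal s) * C)) +
        2 * ENNReal.ofReal s := by gcongr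
    _ = _ := by ring

/-- The error splits into a discretization part and a truncation part. -/
theorem exists_eLpNorm_secondDerivError_le {g : ℂ → ℂ} {d : ℝ} (hd : 0 < d) (hg : MemB2 g d) :
    ∃ C : ℝ, 0 < C ∧ ∀ h : ℝ, 0 < h → ∀ M N : ℕ,
      eLpNorm (secondDerivError g M N h) 2 volume ≤
      ENNReal.ofReal (C * (1 + 1 / h) ^ 2) * (ENNReal.ofReal (1 / Real.sinh (Real.pi * d / h)) +
        ENNReal.ofReal (1 + h) * ∑' k : ℤ,
          if k ∈ Finset.Icc (-(M : ℤ)) N then 0 else ‖g ((k * h : ℝ) : ℂ)‖ₑ) := by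
  obtain ⟨C₀, hC₀, hE⟩ := eventually_eLpNorm_error_le hd hg
  set C₁ := eLpNorm sincSecond 2 volume with hC₁
  have hC₁t : C₁ < ⊤ := memLp_sincSecond.2
  set C : ENNReal := C₀ + 16 * C₁ + 1 with hC
  have hCt : C ≠ ⊤ := by finiteness
  have hC1 : 1 ≤ C := le_add_self
  refine ⟨C.toReal, ENNReal.toReal_pos (by positivity) hCt, fun h hh M N => ?_⟩
  rw [ENNReal.ofReal_mul ENNReal.toReal_nonneg, ENNReal.ofReal_toReal hCt]
  have hmeas : Measurable (secondDerivError g M N h) := by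
    unfold secondDerivError
    simp_rw [iteratedDeriv_succ, iteratedDeriv_zero]
    exact (measurable_deriv _).sub (measurable_deriv _)
  refine eLpNorm_le_of_forall_restrict hmeas.aestronglyMeasurable fun T hT => ?_
  -- `K` depends on `T`, but the bound does not: the finite sum of omitted terms is dominated by the
  -- full tail.
  obtain ⟨K, hK, hMK, hNK⟩ := ((hE h hh T hT).and
    ((eventually_ge_atTop M).and (eventually_ge_atTop N))).exists
  set μ := (volume : Measure ℝ).restrict (Ioo (-T) T)
  set S := Finset.Icc (-(K : ℤ)) K \ Finset.Icc (-(M : ℤ)) N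
  rw [secondDerivError_eq hd hg.analytic hMK hNK]
  have m1 : AEStronglyMeasurable (iteratedDeriv 2 (fun t : ℝ => g t - truncSinc g K K h t)) μ := by
    rw [iteratedDeriv_succ]
    exact (measurable_deriv _).aestronglyMeasurable
  have m2 : ∀ k : ℤ, AEStronglyMeasurable
      (fun x => g ((k * h : ℝ) : ℂ) * iteratedDeriv 2 (fun t : ℝ => (sincBasis k h t : ℂ)) x) μ := by
    intro k
    rw [iteratedDeriv_succ]
    exact ((measurable_deriv _).const_mul _).aestronglyMeasurable
  have b2 : ∀ k : ℤ, eLpNorm (fun x => g ((k * h : ℝ) : ℂ) *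
      iteratedDeriv 2 (fun t : ℝ => (sincBasis k h t : ℂ)) x) 2 μ ≤
      ‖g ((k * h : ℝ) : ℂ)‖ₑ * (ENNReal.ofReal (16 * (1 + 1 / h) ^ 2 * (1 + h)) * C₁) := by
    intro k
    refine (eLpNorm_const_smul_le (c := g ((k * h : ℝ) : ℂ))
      (f := iteratedDeriv 2 (fun t : ℝ => (sincBasis k h t : ℂ)))).trans ?_
    gcongr
    exact (eLpNorm_mono_measure _ Measure.restrict_le_self).trans
      (eLpNorm_iteratedDeriv_sincBasis_le k hh)
  have msum : AEStronglyMeasurable (fun x => ∑ k ∈ S, g ((k * h : ℝ) : ℂ) *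
      iteratedDeriv 2 (fun t : ℝ => (sincBasis k h t : ℂ)) x) μ := by
    exact Finset.aestronglyMeasurable_fun_sum _ fun k _ => m2 k
  have bsum : eLpNorm (fun x => ∑ k ∈ S, g ((k * h : ℝ) : ℂ) *
      iteratedDeriv 2 (fun t : ℝ => (sincBasis k h t : ℂ)) x) 2 μ ≤
      (∑' k : ℤ, if k ∈ Finset.Icc (-(M : ℤ)) N then 0 else ‖g ((k * h : ℝ) : ℂ)‖ₑ) *
        (ENNReal.ofReal (16 * (1 + 1 / h) ^ 2 * (1 + h)) * C₁) := by
    have e : (fun x => ∑ k ∈ S, g ((k * h : ℝ) : ℂ) *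
        iteratedDeriv 2 (fun t : ℝ => (sincBasis k h t : ℂ)) x) = ∑ k ∈ S, fun x =>
        g ((k * h : ℝ) : ℂ) * iteratedDeriv 2 (fun t : ℝ => (sincBasis k h t : ℂ)) x := by
      ext x; simp
    rw [e]
    refine (eLpNorm_sum_le (fun k _ => m2 k) (by norm_num)).trans ?_
    refine (Finset.sum_le_sum fun k _ => b2 k).trans ?_
    rw [← Finset.sum_mul]
    gcongr
    refine le_trans (le_of_eq (Finset.sum_congr rfl fun k hk => ?_)) (ENNReal.sum_le_tsum S)
    rw [if_neg (Finset.mem_sdiff.1 hk).2]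
  refine (eLpNorm_add_le m1 msum (by norm_num)).trans ?_
  refine (add_le_add hK bsum).trans ?_
  set P := ENNReal.ofReal ((1 + 1 / h) ^ 2)
  set Z := ENNReal.ofReal (1 / Real.sinh (Real.pi * d / h))
  set Y := ∑' k : ℤ, if k ∈ Finset.Icc (-(M : ℤ)) N then 0 else ‖g ((k * h : ℝ) : ℂ)‖ₑ
  rw [ENNReal.ofReal_mul (by positivity), ENNReal.ofReal_mul (by norm_num), ENNReal.ofReal_ofNat]
  have c0 : C₀ ≤ C := le_self_add.trans le_self_add
  have c1 : 16 * C₁ ≤ C := le_add_self.trans le_self_add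
  calc P * (Z * C₀) + Y * (16 * P * ENNReal.ofReal (1 + h) * C₁)
      = P * (Z * C₀) + Y * (P * ENNReal.ofReal (1 + h) * (16 * C₁)) := by ring
    _ ≤ P * (Z * C) + Y * (P * ENNReal.ofReal (1 + h) * C) := by gcongr
    _ = _ := by ring

end

end

/-! ### The Lambert W function, the mesh and the numbers of nodes -/

section

open Set

/-- `Function.invFunOn` is meaningful only where a preimage exists; for `X ≥ 0` the intermediate
value theorem on `[0, X]` supplies one. -/
theorem lambertW_spec {X : ℝ} (hX : 0 ≤ X) :
    lambertW X ∈ Ici (-1 : ℝ) ∧ lambertW X * Real.exp (lambertW X) = X := by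
  have hex : ∃ w ∈ Ici (-1 : ℝ), w * Real.exp w = X := by
    have hc : ContinuousOn (fun w : ℝ => w * Real.exp w) (Icc 0 X) := by fun_prop
    have hX' : X ∈ Icc (0 * Real.exp 0) (X * Real.exp X) :=
      ⟨by simpa using hX, le_mul_of_one_le_right hX (Real.one_le_exp hX)⟩
    obtain ⟨w, hw, hwX⟩ := intermediate_value_Icc hX hc hX'
    exact ⟨w, mem_Ici.2 (by linarith [hw.1]), hwX⟩
  exact ⟨Function.invFunOn_mem hex, Function.invFunOn_eq hex⟩

theorem le_lambertW {w X : ℝ} (hw : 0 ≤ w) (hX : w * Real.exp w ≤ X) : w ≤ lambertW X := by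
  have hX0 : 0 ≤ X := le_trans (by positivity) hX
  obtain ⟨-, h⟩ := lambertW_spec hX0
  by_contra! hlt
  rcases lt_or_ge (lambertW X) 0 with h0 | h0
  · have := mul_neg_of_neg_of_pos h0 (Real.exp_pos (lambertW X))
    linarith
  · have : lambertW X * Real.exp (lambertW X) < w * Real.exp w := by
      have := Real.exp_lt_exp.2 hlt
      have := Real.exp_pos (lambertW X)
      nlinarith
    linarith

theorem tendsto_lambertW : Tendsto lambertW atTop atTop := by
  refine tendsto_atTop.2 fun b => ?_
  filter_upwards [eventually_ge_atTop (max b 0 * Real.exp (max b 0))] with X hX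
  exact (le_max_left _ _).trans (le_lambertW (le_max_right _ _) hX)

theorem log_eq_lambertW_add {X : ℝ} (hX : 0 ≤ X) (hW : 0 < lambertW X) :
    Real.log X = lambertW X + Real.log (lambertW X) := by
  conv_lhs => rw [← (lambertW_spec hX).2]
  rw [Real.log_mul hW.ne' (Real.exp_pos _).ne', Real.log_exp, add_comm]

section mesh
variable {d γ β : ℝ}

theorem tendsto_mesh_arg (hd : 0 < d) (hγ : 0 < γ) (hβ : 0 < β) :
    Tendsto (fun n : ℕ => Real.pi * d * γ * n / β) atTop atTop := by
  have hpi := Real.pi_pos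
  exact (tendsto_natCast_atTop_atTop.const_mul_atTop (by positivity)).atTop_div_const hβ

theorem tendsto_log_div_self : Tendsto (fun x : ℝ => Real.log x / x) atTop (𝓝 0) :=
  Real.isLittleO_log_id_atTop.tendsto_div_nhds_zero

theorem tendsto_meshSize (hd : 0 < d) (hγ : 0 < γ) (hβ : 0 < β) :
    Tendsto (meshSize d γ β) atTop (𝓝 0) := by
  have hpi := Real.pi_pos
  have h1 := (tendsto_log_div_self.comp (tendsto_mesh_arg hd hγ hβ)).const_mul (Real.pi * d / β)
  rw [mul_zero] at h1
  refine h1.congr' ?_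
  filter_upwards [eventually_gt_atTop 0] with n hn
  have : (n : ℝ) ≠ 0 := by exact_mod_cast hn.ne'
  simp only [Function.comp, meshSize]
  field_simp

theorem meshSize_pos (hγ : 0 < γ) (hβ : 0 < β) {n : ℕ} (hn : 0 < n)
    (h : β < Real.pi * d * γ * n) : 0 < meshSize d γ β n := by
  have : (0 : ℝ) < n := by exact_mod_cast hn
  exact div_pos (Real.log_pos ((one_lt_div hβ).2 h)) (by positivity)

theorem eventually_lt_mesh_arg (hd : 0 < d) (hγ : 0 < γ) (hβ : 0 < β) :
    ∀ᶠ n : ℕ in atTop, β < Real.pi * d * γ * n := by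
  filter_upwards [(tendsto_mesh_arg hd hγ hβ).eventually_gt_atTop 1] with n hn
  exact (one_lt_div hβ).1 hn

/-- The purpose of the mesh: at the node `n h` the double exponential has exponent exactly `π d γ
n`. -/
theorem mul_exp_meshSize (hd : 0 < d) (hγ : 0 < γ) (hβ : 0 < β) {n : ℕ} (hn : 0 < n) :
    β * Real.exp (γ * n * meshSize d γ β n) = Real.pi * d * γ * n := by
  have hn' : (0 : ℝ) < n := by exact_mod_cast hn
  have hpi := Real.pi_pos
  rw [meshSize, mul_div_cancel₀ _ (by positivity), Real.exp_log (by positivity)]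
  field_simp

end mesh

/-- The number of Sinc points on the other side is large enough. -/
theorem eventually_half_le_mul_exp {d γ₁ γ₂ β₁ β₂ : ℝ} (hd : 0 < d) (hγ₁ : 0 < γ₁) (hγ₂ : 0 < γ₂)
    (hβ₁ : 0 < β₁) (hβ₂ : 0 < β₂) :
    ∀ᶠ n : ℕ in atTop, ∀ m : ℕ,
      γ₁ / γ₂ * n * (1 + Real.log (β₁ / β₂) / lambertW (Real.pi * d * γ₁ * n / β₁)) - 1 ≤ m →
      Real.pi * d * γ₁ * n / 2 ≤ β₂ * Real.exp (γ₂ * m * meshSize d γ₁ β₁ n) := by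
  have hpi := Real.pi_pos
  have hX := tendsto_mesh_arg hd hγ₁ hβ₁
  have hW := tendsto_lambertW.comp hX
  -- The defect in the exponent from replacing `log X` by `W` in the rule and from rounding by less
  -- than one node. It tends to zero, so it eventually costs at most a factor `2`.
  have herr : Tendsto (fun n : ℕ => Real.log (β₁ / β₂) *
      (Real.log (lambertW (Real.pi * d * γ₁ * n / β₁)) / lambertW (Real.pi * d * γ₁ * n / β₁)) -
      γ₂ * meshSize d γ₁ β₁ n) atTop (𝓝 0) := by
    have := ((tendsto_log_div_self.comp hW).const_mul (Real.log (β₁ / β₂))).sub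
      ((tendsto_meshSize hd hγ₁ hβ₁).const_mul γ₂)
    simpa using this
  have hlog2 : -Real.log 2 < 0 := by simpa using Real.log_pos one_lt_two
  filter_upwards [herr.eventually_const_lt hlog2, hW.eventually_gt_atTop 0,
    eventually_gt_atTop 0, eventually_lt_mesh_arg hd hγ₁ hβ₁] with n he hWn hn hlt m hm
  have hn' : (0 : ℝ) < n := by exact_mod_cast hn
  have hh := meshSize_pos hγ₁ hβ₁ hn hlt
  have hexp := mul_exp_meshSize hd hγ₁ hβ₁ hn
  set h := meshSize d γ₁ β₁ n with hdef
  set X := Real.pi * d * γ₁ * n / β₁ with hXdef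
  have hX0 : 0 < X := by positivity
  simp only [Function.comp] at hWn
  set W := lambertW X
  set ℓ := Real.log (β₁ / β₂) with hℓ
  have hlogX : γ₁ * n * h = Real.log X := by
    rw [hdef, meshSize, mul_div_cancel₀ _ (by positivity)]
  have hlX : Real.log X = W + Real.log W := log_eq_lambertW_add hX0.le hWn
  have h1 : γ₂ * h * (γ₁ / γ₂ * n * (1 + ℓ / W) - 1) ≤ γ₂ * h * m := by gcongr
  -- By `log X = W + log W`, the product `log X * (1 + ℓ / W)` is `log X + ℓ` up to `ℓ * log W / W`.
  -- The shift `ℓ` replaces `β₂` by `β₁`, so the exponent on the other side is `β₁ * X = π d γ₁ n`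
  -- up to the defect.
  have h2 : γ₂ * h * (γ₁ / γ₂ * n * (1 + ℓ / W) - 1) =
      Real.log X + ℓ + (ℓ * (Real.log W / W) - γ₂ * h) := by
    have : γ₂ * h * (γ₁ / γ₂ * n * (1 + ℓ / W) - 1) =
        (γ₁ * n * h) * (1 + ℓ / W) - γ₂ * h := by field_simp
    rw [this, hlogX]
    have h3 : Real.log X * (1 + ℓ / W) = Real.log X + ℓ + ℓ * (Real.log W / W) := by
      rw [hlX]; field_simp; ring
    rw [h3]; ring
  have h4 : Real.log X + ℓ - Real.log 2 ≤ γ₂ * m * h := by linarith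
  calc Real.pi * d * γ₁ * n / 2 = β₂ * Real.exp (Real.log X + ℓ - Real.log 2) := by
        rw [Real.exp_sub, Real.exp_add, Real.exp_log hX0, hℓ, Real.exp_log (by positivity),
          Real.exp_log two_pos, hXdef]
        field_simp
    _ ≤ _ := by gcongr

theorem IsChoice.eq_or_eq {d βL βR γL γR β : ℝ} {M N n : ℕ}
    (hc : IsChoice d βL βR γL γR M N n β) : β = βL ∨ β = βR := by
  rcases hc with h | h | h | h
  · exact Or.inl h.2.2.1
  · exact Or.inr h.2.2.1
  · exact Or.inl h.2.2.2.1
  · exact Or.inr h.2.2.2.1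

theorem exists_forall_half_le {d βL βR γL γR : ℝ} (hd : 0 < d) (hβL : 0 < βL) (hβR : 0 < βR)
    (hγL : 0 < γL) (hγR : 0 < γR) :
    ∃ n₀ : ℕ, ∀ (M N n : ℕ) (β : ℝ), IsChoice d βL βR γL γR M N n β → n₀ ≤ n →
      Real.pi * d * max γL γR * n / 2 ≤
        βL * Real.exp (γL * M * meshSize d (max γL γR) β n) ∧
      Real.pi * d * max γL γR * n / 2 ≤
        βR * Real.exp (γR * N * meshSize d (max γL γR) β n) := by
  have hpi := Real.pi_pos
  obtain ⟨n₀, hn₀⟩ := eventually_atTop.1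
    ((eventually_half_le_mul_exp hd hγL hγR hβL hβR).and
      ((eventually_half_le_mul_exp hd hγR hγL hβR hβL).and (eventually_gt_atTop 0)))
  refine ⟨n₀, fun M N n β hc hn => ?_⟩
  obtain ⟨hL, hR, hn0⟩ := hn₀ n hn
  have hn' : (0 : ℝ) < n := by exact_mod_cast hn0
  have eL := mul_exp_meshSize hd hγL hβL hn0
  have eR := mul_exp_meshSize hd hγR hβR hn0
  have pL : 0 < Real.pi * d * γL * n := by positivity
  have pR : 0 < Real.pi * d * γR * n := by positivity
  rcases hc with ⟨hlt, rfl, rfl, hN⟩ | ⟨hlt, rfl, rfl, hM⟩ | ⟨rfl, -, rfl, rfl, hN⟩ |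
    ⟨rfl, -, rfl, rfl, hM⟩
  · rw [max_eq_left hlt.le]
    refine ⟨by linarith, hL N ?_⟩
    -- Only a lower bound on `N` is needed, so the positive part does no harm.
    have h1 := (Int.le_ceil _).trans (Int.cast_le.2 ((le_max_left _ _).trans hN.ge))
    push_cast at h1
    linarith
  · rw [max_eq_right hlt.le]
    refine ⟨hR M ?_, by linarith⟩
    have h1 := (Int.sub_one_lt_floor _).le.trans (Int.cast_le.2 ((le_max_left _ _).trans hM.ge))
    push_cast at h1
    linarith
  · rw [max_self]
    refine ⟨by linarith, hL N ?_⟩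
    have h1 := (Int.le_ceil _).trans (Int.cast_le.2 hN.ge)
    push_cast at h1
    rw [div_self hγL.ne', one_mul]
    linarith
  · rw [max_self]
    refine ⟨hR M ?_, by linarith⟩
    have h1 := (Int.sub_one_lt_floor _).le.trans (Int.cast_le.2 hM.ge)
    push_cast at h1
    rw [div_self hγL.ne', one_mul]
    linarith

/-! ### The tail of the node values and the total error -/

theorem tsum_ofReal_exp_le {B c : ℝ} (hB : 0 ≤ B) (hc : 0 < c) :
    ∑' n : ℕ, ENNReal.ofReal (B * Real.exp (-(c * n))) ≤ ENNReal.ofReal (B * (1 + 1 / c)) := by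
  have hr : Real.exp (-c) < 1 := by simpa using hc
  have hs := (hasSum_geometric_of_lt_one (Real.exp_pos (-c)).le hr).mul_left B
  have he : (fun n : ℕ => B * Real.exp (-c) ^ n) = fun n : ℕ => B * Real.exp (-(c * n)) := by
    ext n
    rw [← Real.exp_nat_mul]; ring_nf
  rw [he] at hs
  rw [← ENNReal.ofReal_tsum_of_nonneg (fun n => by positivity) hs.summable, hs.tsum_eq]
  gcongr
  have h1 : Real.exp (-c) ≤ 1 / (1 + c) := by
    rw [Real.exp_neg, ← one_div]
    gcongr
    linarith [Real.add_one_le_exp c]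
  have h2 : c / (1 + c) ≤ 1 - Real.exp (-c) := by
    have : c / (1 + c) = 1 - 1 / (1 + c) := by field_simp; ring
    linarith
  calc (1 - Real.exp (-c))⁻¹ ≤ (c / (1 + c))⁻¹ := by gcongr
    _ = 1 + 1 / c := by field_simp; ring

/-- The exponent is split in two halves: monotonicity beyond the node `m` turns one into the gain `q
/ 2`, and `exp s ≥ s` turns the other into a geometric factor summable over the nodes. -/
theorem mul_exp_neg_double_exp_le {A β γ h q k m : ℝ} (hA : 0 ≤ A) (hβ : 0 < β) (hγ : 0 < γ)
    (hh : 0 < h) (hmk : m ≤ k) (hq : q ≤ β * Real.exp (γ * m * h)) :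
    A * Real.exp (-β * Real.exp (γ * (k * h))) ≤
      A * Real.exp (-(q / 2)) * Real.exp (-(β * γ * h / 2 * k)) := by
  rw [mul_assoc, ← Real.exp_add]
  gcongr
  have h1 : Real.exp (γ * m * h) ≤ Real.exp (γ * (k * h)) := by
    rw [mul_assoc]; gcongr
  have h2 := Real.add_one_le_exp (γ * (k * h))
  have h3 : β * Real.exp (γ * m * h) ≤ β * Real.exp (γ * (k * h)) := by gcongr
  have h4 : β * (γ * (k * h)) ≤ β * Real.exp (γ * (k * h)) := by gcongr; linarith
  linarith

theorem DEDecay.tsum_tail_le {g : ℂ → ℂ} {A βL βR γL γR : ℝ} (hg : DEDecay g A βL βR γL γR)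
    {h q : ℝ} (hh : 0 < h) {M N : ℕ} (hM : q ≤ βL * Real.exp (γL * M * h))
    (hN : q ≤ βR * Real.exp (γR * N * h)) :
    ∑' k : ℤ, (if k ∈ Finset.Icc (-(M : ℤ)) N then 0 else ‖g ((k * h : ℝ) : ℂ)‖ₑ) ≤
      ENNReal.ofReal (A * Real.exp (-(q / 2)) *
        (2 + (1 / (βR * γR * h / 2) + 1 / (βL * γL * h / 2)))) := by
  obtain ⟨hA, hβL, hβR, hγL, hγR, hleft, hright⟩ := hg
  rw [tsum_of_nat_of_neg_add_one ENNReal.summable ENNReal.summable]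
  have h1 : ∑' n : ℕ, (if (n : ℤ) ∈ Finset.Icc (-(M : ℤ)) N then 0
      else ‖g (((n : ℤ) * h : ℝ) : ℂ)‖ₑ) ≤
      ENNReal.ofReal (A * Real.exp (-(q / 2)) * (1 + 1 / (βR * γR * h / 2))) := by
    refine (ENNReal.tsum_le_tsum fun n => ?_).trans
      (tsum_ofReal_exp_le (by positivity) (by positivity))
    split_ifs with hn
    · exact bot_le
    · have hn' : (N : ℝ) ≤ n := by
        rw [Finset.mem_Icc] at hn
        exact_mod_cast (by omega : N ≤ n)
      rw [← ofReal_norm]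
      refine ENNReal.ofReal_le_ofReal ((hright _ (by positivity)).trans ?_)
      rw [abs_of_nonneg (by positivity), Int.cast_natCast]
      exact mul_exp_neg_double_exp_le hA.le hβR hγR hh hn' hN
  have h2 : ∑' n : ℕ, (if -((n : ℤ) + 1) ∈ Finset.Icc (-(M : ℤ)) N then 0
      else ‖g (((-((n : ℤ) + 1) : ℤ) * h : ℝ) : ℂ)‖ₑ) ≤
      ENNReal.ofReal (A * Real.exp (-(q / 2)) * (1 + 1 / (βL * γL * h / 2))) := by
    refine (ENNReal.tsum_le_tsum fun n => ?_).trans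
      (tsum_ofReal_exp_le (by positivity) (by positivity))
    split_ifs with hn
    · exact bot_le
    · have hn' : (M : ℝ) ≤ (n : ℝ) + 1 := by
        rw [Finset.mem_Icc] at hn
        exact_mod_cast (by omega : M ≤ n + 1)
      have hx : ((-((n : ℤ) + 1) : ℤ) * h : ℝ) = -(((n : ℝ) + 1) * h) := by push_cast; ring
      have hx0 : 0 ≤ ((n : ℝ) + 1) * h := by positivity
      rw [← ofReal_norm, hx]
      refine ENNReal.ofReal_le_ofReal ((hleft _ (by linarith)).trans ?_)
      rw [abs_neg, abs_of_nonneg hx0]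
      refine (mul_exp_neg_double_exp_le hA.le hβL hγL hh hn' hM).trans ?_
      gcongr
      linarith
  refine (add_le_add h1 h2).trans (le_of_eq ?_)
  rw [← ENNReal.ofReal_add (by positivity) (by positivity)]
  congr 1
  ring

/-- An explicit bound for the error, given that `q` bounds the decay at the outermost nodes. -/
def errorBound (C κ d h q : ℝ) : ℝ :=
  C * (1 + 1 / h) ^ 2 *
    (1 / Real.sinh (Real.pi * d / h) + (1 + h) * (κ * (1 + 1 / h) * Real.exp (-(q / 2))))

/-- The constants are independent of `h`, `q`, `M` and `N`. Leaving `q` free serves both large `n`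
and, with `q = 0`, the finitely many small ones. -/
theorem exists_le_errorBound {g : ℂ → ℂ} {d A βL βR γL γR : ℝ} (hd : 0 < d) (hg : MemB2 g d)
    (hdec : DEDecay g A βL βR γL γR) :
    ∃ C κ : ℝ, 0 < C ∧ 0 < κ ∧ ∀ (h q : ℝ) (M N : ℕ), 0 < h →
      q ≤ βL * Real.exp (γL * M * h) → q ≤ βR * Real.exp (γR * N * h) →
      eLpNorm (secondDerivError g M N h) 2 volume ≤ ENNReal.ofReal (errorBound C κ d h q) := by
  obtain ⟨C, hC, hE⟩ := exists_eLpNorm_secondDerivError_le hd hg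
  have hA := hdec.A_pos
  have hβL := hdec.βL_pos
  have hβR := hdec.βR_pos
  have hγL := hdec.γL_pos
  have hγR := hdec.γR_pos
  refine ⟨C, A * (2 + (2 / (βR * γR) + 2 / (βL * γL))), hC, by positivity,
    fun h q M N hh hM hN => (hE h hh M N).trans ?_⟩
  have hs : 0 < Real.sinh (Real.pi * d / h) :=
    Real.sinh_pos_iff.2 (by have := Real.pi_pos; positivity)
  have htail := hdec.tsum_tail_le hh hM hN
  rw [errorBound, ENNReal.ofReal_mul (p := C * (1 + 1 / h) ^ 2) (by positivity),
    ENNReal.ofReal_add (p := 1 / Real.sinh (Real.pi * d / h)) (by positivity) (by positivity),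
    ENNReal.ofReal_mul (p := 1 + h) (by positivity)]
  gcongr
  refine htail.trans (ENNReal.ofReal_le_ofReal ?_)
  have : 2 + (1 / (βR * γR * h / 2) + 1 / (βL * γL * h / 2)) ≤
      (2 + (2 / (βR * γR) + 2 / (βL * γL))) * (1 + 1 / h) := by
    have e : 1 / (βR * γR * h / 2) + 1 / (βL * γL * h / 2) =
        (2 / (βR * γR) + 2 / (βL * γL)) * (1 / h) := by field_simp
    rw [e]
    have : 0 < 1 / h := by positivity
    have : 0 < 2 / (βR * γR) + 2 / (βL * γL) := by positivity
    nlinarith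
  calc _ ≤ A * Real.exp (-(q / 2)) * ((2 + (2 / (βR * γR) + 2 / (βL * γL))) * (1 + 1 / h)) := by
        gcongr
    _ = _ := by ring

/-! ### Comparison with the convergence rate -/

theorem one_div_sinh_le {y : ℝ} (hy : 1 ≤ y) : 1 / Real.sinh y ≤ 4 * Real.exp (-y) := by
  rw [Real.exp_neg, ← div_eq_mul_inv]
  have h1 : 2 ≤ Real.exp y := by linarith [Real.add_one_le_exp y]
  have h2 : Real.exp (-y) ≤ 1 := Real.exp_le_one_iff.2 (by linarith)
  rw [div_le_div_iff₀ (Real.sinh_pos_iff.2 (by linarith)) (Real.exp_pos y), Real.sinh_eq]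
  linarith

theorem eventually_errorBound_le_rate {C κ d γ β : ℝ} (hC : 0 < C) (hκ : 0 < κ) (hd : 0 < d)
    (hγ : 0 < γ) (hβ : 0 < β) :
    ∀ᶠ n : ℕ in atTop,
      errorBound C κ d (meshSize d γ β n) (Real.pi * d * γ * n / 2) ≤ rate d γ β n := by
  have hpi := Real.pi_pos
  have hX := tendsto_mesh_arg hd hγ hβ
  have hlogX := Real.tendsto_log_atTop.comp hX
  have hlogn := Real.tendsto_log_atTop.comp (tendsto_natCast_atTop_atTop (R := ℝ))
  have hu : Tendsto (fun n : ℕ => (n : ℝ) / Real.log n) atTop atTop := by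
    have h1 : Tendsto (fun n : ℕ => Real.log n / (n : ℝ)) atTop (𝓝[>] 0) := by
      refine tendsto_nhdsWithin_iff.2
        ⟨tendsto_log_div_self.comp tendsto_natCast_atTop_atTop, ?_⟩
      filter_upwards [hlogn.eventually_gt_atTop 0, eventually_gt_atTop 0] with n h1 h2
      have h1' : 0 < Real.log (n : ℝ) := h1
      have h2' : (0 : ℝ) < n := by exact_mod_cast h2
      exact div_pos h1' h2'
    refine h1.inv_tendsto_nhdsGT_zero.congr fun n => ?_
    simp
  have hsqrt := (tendsto_rpow_atTop (by norm_num : (0 : ℝ) < 1 / 2)).comp hu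
  have hexp : Tendsto (fun n : ℕ => 4 * C * κ * (1 + 2 * γ) ^ 3 *
      ((n : ℝ) ^ 3 * Real.exp (-(Real.pi * d * γ / 8) * n))) atTop (𝓝 0) := by
    have h1 := (Real.tendsto_pow_mul_exp_neg_atTop_nhds_zero 3).comp
      ((tendsto_natCast_atTop_atTop (R := ℝ)).const_mul_atTop
        (show 0 < Real.pi * d * γ / 8 by positivity))
    have h2 := h1.const_mul (4 * C * κ * (1 + 2 * γ) ^ 3 * ((Real.pi * d * γ / 8) ^ 3)⁻¹)
    rw [mul_zero] at h2
    refine h2.congr fun n => ?_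
    simp only [Function.comp, mul_pow, neg_mul]
    field_simp
  have hm := tendsto_meshSize hd hγ hβ
  have hconst : ∀ᶠ n : ℕ in atTop, -(Real.log (Real.pi * d * γ / β)) ≤ Real.log n / 2 := by
    filter_upwards [hlogn.eventually_ge_atTop (2 * -(Real.log (Real.pi * d * γ / β)))] with n h1
    have h1' : 2 * -(Real.log (Real.pi * d * γ / β)) ≤ Real.log (n : ℝ) := h1
    linarith
  filter_upwards [hlogX.eventually_ge_atTop 8, hlogn.eventually_ge_atTop 1,
    hu.eventually_ge_atTop 1, hsqrt.eventually_ge_atTop (8 * C * (1 + 2 * γ) ^ 2),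
    hexp.eventually_le_const one_pos, hm.eventually_le_const (show (0 : ℝ) < 1 by norm_num),
    hm.eventually_le_const (show 0 < Real.pi * d by positivity), hconst,
    eventually_gt_atTop 0, eventually_lt_mesh_arg hd hγ hβ]
    with n hX8 hln1 hu1 hs he hh1 hhd hcn hn hlt
  have hn' : (0 : ℝ) < n := by exact_mod_cast hn
  have hh := meshSize_pos hγ hβ hn hlt
  simp only [Function.comp] at hX8 hln1 hs
  have hlog : Real.log (Real.pi * d * γ * n / β) =
      Real.log (Real.pi * d * γ / β) + Real.log n := by
    rw [← Real.log_mul (by positivity) (by positivity)]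
    congr 1; ring
  set ℓ := Real.log (Real.pi * d * γ * n / β) with hℓ
  have hhdef : meshSize d γ β n = ℓ / (γ * n) := rfl
  set h := meshSize d γ β n
  set u : ℝ := (n : ℝ) / Real.log n with hudef
  have hℓ2 : Real.log n / 2 ≤ ℓ := by linarith
  -- Here `1 / h = γ n / ℓ`, and `ℓ ≥ log n / 2` for large `n` whatever the constants inside the
  -- logarithm.
  have hinv : 1 / h ≤ 2 * γ * u := by
    rw [hhdef, hudef, one_div_div, ← mul_div_assoc, div_le_div_iff₀ (by linarith) (by linarith)]
    have : γ * n * Real.log n ≤ γ * n * (2 * ℓ) := by gcongr; linarith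
    linarith
  have hinv1 : 1 + 1 / h ≤ (1 + 2 * γ) * u := by nlinarith
  have hinv0 : 0 < 1 / h := by positivity
  have hun : u ≤ n := div_le_self hn'.le hln1
  have hexpo : Real.pi * d / h = Real.pi * d * γ * n / ℓ := by rw [hhdef]; field_simp
  set E := Real.exp (-(Real.pi * d * γ * n / ℓ)) with hE
  have hu0 : 0 < u := by linarith
  have hrate : rate d γ β n = u ^ (5 / 2 : ℝ) * E := rfl
  have hup : u ^ (5 / 2 : ℝ) = u ^ 2 * u ^ (1 / 2 : ℝ) := by
    rw [← Real.rpow_natCast u 2, ← Real.rpow_add hu0]; norm_num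
  have hup1 : 1 ≤ u ^ (5 / 2 : ℝ) := Real.one_le_rpow hu1 (by norm_num)
  have hE0 : 0 < E := Real.exp_pos _
  have hsinh : 1 / Real.sinh (Real.pi * d / h) ≤ 4 * E := by
    rw [hE, ← hexpo]
    exact one_div_sinh_le ((one_le_div hh).2 hhd)
  -- Since `ℓ ≥ 8`, half of the exponent `π d γ n / 4` pays for `E`; the other half is left in `F`
  -- to beat `n ^ 3`.
  have hsecond : Real.exp (-(Real.pi * d * γ * n / 2 / 2)) ≤
      E * Real.exp (-(Real.pi * d * γ / 8) * n) := by
    rw [hE, ← Real.exp_add]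
    gcongr
    have : Real.pi * d * γ * n / ℓ ≤ Real.pi * d * γ * n / 8 := by gcongr
    linarith
  set F := Real.exp (-(Real.pi * d * γ / 8) * n) with hF
  have hF0 : 0 < F := Real.exp_pos _
  -- The spare factor `u ^ (1 / 2)` exceeds `8 * C * (1 + 2 * γ) ^ 2`; this is where every constant
  -- disappears.
  have part1 : C * (1 + 1 / h) ^ 2 * (4 * E) ≤ u ^ (5 / 2 : ℝ) * E / 2 := by
    calc C * (1 + 1 / h) ^ 2 * (4 * E) ≤ C * ((1 + 2 * γ) * u) ^ 2 * (4 * E) := by gcongr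
      _ = (8 * C * (1 + 2 * γ) ^ 2) * u ^ 2 * E / 2 := by ring
      _ ≤ u ^ (1 / 2 : ℝ) * u ^ 2 * E / 2 := by gcongr
      _ = _ := by rw [hup]; ring
  have part2 : C * (1 + 1 / h) ^ 2 * ((1 + h) * (κ * (1 + 1 / h) * (E * F))) ≤
      u ^ (5 / 2 : ℝ) * E / 2 := by
    calc C * (1 + 1 / h) ^ 2 * ((1 + h) * (κ * (1 + 1 / h) * (E * F)))
        ≤ C * ((1 + 2 * γ) * n) ^ 2 * ((1 + 1) * (κ * ((1 + 2 * γ) * n) * (E * F))) := by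
          have : 1 + 1 / h ≤ (1 + 2 * γ) * n := hinv1.trans (by gcongr)
          gcongr
      _ = (4 * C * κ * (1 + 2 * γ) ^ 3 * ((n : ℝ) ^ 3 * F)) * E / 2 := by ring
      _ ≤ 1 * E / 2 := by gcongr
      _ ≤ _ := by gcongr
  rw [hrate, errorBound]
  calc _ ≤ C * (1 + 1 / h) ^ 2 * (4 * E + (1 + h) * (κ * (1 + 1 / h) * (E * F))) := by gcongr
    _ = C * (1 + 1 / h) ^ 2 * (4 * E) +
        C * (1 + 1 / h) ^ 2 * ((1 + h) * (κ * (1 + 1 / h) * (E * F))) := by ring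
    _ ≤ u ^ (5 / 2 : ℝ) * E / 2 + u ^ (5 / 2 : ℝ) * E / 2 := add_le_add part1 part2
    _ = _ := by ring

theorem rate_pos (d γ β : ℝ) {n : ℕ} (hn : 2 ≤ n) : 0 < rate d γ β n := by
  have : (1 : ℝ) < n := by exact_mod_cast hn
  have := Real.log_pos this
  unfold rate
  positivity

/-- For large `n` the error is at most the rate, with constant `1`. -/
theorem exists_forall_le_rate {g : ℂ → ℂ} {d A βL βR γL γR : ℝ} (hd : 0 < d) (hg : MemB2 g d)
    (hdec : DEDecay g A βL βR γL γR) :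
    ∃ n₀ : ℕ, ∀ (M N n : ℕ) (β : ℝ), IsChoice d βL βR γL γR M N n β → n₀ ≤ n →
      eLpNorm (secondDerivError g M N (meshSize d (max γL γR) β n)) 2 volume ≤
        ENNReal.ofReal (rate d (max γL γR) β n) := by
  obtain ⟨C, κ, hC, hκ, hE⟩ := exists_le_errorBound hd hg hdec
  have hγ : 0 < max γL γR := lt_max_of_lt_left hdec.γL_pos
  obtain ⟨n₁, hn₁⟩ := exists_forall_half_le hd hdec.βL_pos hdec.βR_pos hdec.γL_pos hdec.γR_pos
  have hev : ∀ β : ℝ, 0 < β → ∀ᶠ n : ℕ in atTop,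
      errorBound C κ d (meshSize d (max γL γR) β n) (Real.pi * d * max γL γR * n / 2) ≤
        rate d (max γL γR) β n ∧ 0 < meshSize d (max γL γR) β n := by
    intro β hβ
    filter_upwards [eventually_errorBound_le_rate hC hκ hd hγ hβ, eventually_gt_atTop 0,
      eventually_lt_mesh_arg hd hγ hβ] with n h1 h2 h3
    exact ⟨h1, meshSize_pos hγ hβ h2 h3⟩
  obtain ⟨n₂, hn₂⟩ := eventually_atTop.1 ((hev βL hdec.βL_pos).and (hev βR hdec.βR_pos))
  refine ⟨max n₁ n₂, fun M N n β hc hn => ?_⟩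
  obtain ⟨hM, hN⟩ := hn₁ M N n β hc (le_of_max_le_left hn)
  obtain ⟨h1, h2⟩ := hn₂ n (le_of_max_le_right hn)
  have h3 : errorBound C κ d (meshSize d (max γL γR) β n) (Real.pi * d * max γL γR * n / 2) ≤
        rate d (max γL γR) β n ∧ 0 < meshSize d (max γL γR) β n := by
    rcases hc.eq_or_eq with rfl | rfl
    · exact h1
    · exact h2
  exact (hE _ _ M N h3.2 hM hN).trans (ENNReal.ofReal_le_ofReal h3.1)

end

end DESinc

end

/-! ### The two statements -/

theorem lemma1 (g : ℂ → ℂ) (d : ℝ) (hd : 0 < d) (hg : DESinc.MemB2 g d) :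
    -- for given decay constants, one `K` serves all admissible `n`
    (∀ A βL βR γL γR : ℝ, DESinc.DEDecay g A βL βR γL γR →
      d ≤ Real.pi / (2 * max γL γR) →
      ∃ K : ℝ, 0 < K ∧ ∀ (M N n : ℕ) (β : ℝ), DESinc.IsChoice d βL βR γL γR M N n β →
        2 ≤ n → β < Real.pi * d * max γL γR * n →
        eLpNorm (DESinc.secondDerivError g M N (DESinc.meshSize d (max γL γR) β n)) 2 volume
          ≤ ENNReal.ofReal (K * DESinc.rate d (max γL γR) β n)) ∧
    -- for large `n`, one `K`, depending on `g` and `d` alone, serves all decay constants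
    (∃ K : ℝ, 0 < K ∧ ∀ A βL βR γL γR : ℝ, DESinc.DEDecay g A βL βR γL γR →
      d ≤ Real.pi / (2 * max γL γR) →
      ∃ n₀ : ℕ, ∀ (M N n : ℕ) (β : ℝ), DESinc.IsChoice d βL βR γL γR M N n β →
        n₀ ≤ n →
        eLpNorm (DESinc.secondDerivError g M N (DESinc.meshSize d (max γL γR) β n)) 2 volume
          ≤ ENNReal.ofReal (K * DESinc.rate d (max γL γR) β n)) := by
  -- The constant in (ii) can be `1`, since the threshold `n₀` may depend on the decay constants.
  refine ⟨fun A βL βR γL γR hdec _ => ?_, 1, one_pos, fun A βL βR γL γR hdec _ => ?_⟩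
  · obtain ⟨n₀, hn₀⟩ := DESinc.exists_forall_le_rate hd hg hdec
    obtain ⟨C, κ, hC, hκ, hE⟩ := DESinc.exists_le_errorBound hd hg hdec
    have hγ : 0 < max γL γR := lt_max_of_lt_left hdec.γL_pos
    -- The quotient of the `q = 0` bound by the rate does not involve `M` or `N`. Summing it over `n
    -- < n₀` and both candidates for `β` gives one constant for the remaining cases.
    let Q : ℝ → ℕ → ℝ := fun β n =>
      |DESinc.errorBound C κ d (DESinc.meshSize d (max γL γR) β n) 0 /
        DESinc.rate d (max γL γR) β n|
    refine ⟨1 + ∑ n ∈ Finset.range n₀, (Q βL n + Q βR n), by positivity,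
      fun M N n β hc hn2 hβ => ?_⟩
    have hr := DESinc.rate_pos d (max γL γR) β hn2
    have hsum : 0 ≤ ∑ n ∈ Finset.range n₀, (Q βL n + Q βR n) := by positivity
    rcases le_or_gt n₀ n with hn | hn
    · refine (hn₀ M N n β hc hn).trans (ENNReal.ofReal_le_ofReal ?_)
      exact le_mul_of_one_le_left hr.le (by linarith)
    · have hβ0 : 0 < β := by
        rcases hc.eq_or_eq with rfl | rfl
        · exact hdec.βL_pos
        · exact hdec.βR_pos
      have hh := DESinc.meshSize_pos hγ hβ0 (by omega) hβ
      refine (hE _ 0 M N hh (by have := hdec.βL_pos; positivity)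
        (by have := hdec.βR_pos; positivity)).trans (ENNReal.ofReal_le_ofReal ?_)
      rw [← div_le_iff₀ hr]
      have h1 : Q βL n + Q βR n ≤ ∑ n ∈ Finset.range n₀, (Q βL n + Q βR n) :=
        Finset.single_le_sum (f := fun n => Q βL n + Q βR n) (fun _ _ => by positivity)
          (Finset.mem_range.2 hn)
      have h2 : Q β n ≤ Q βL n + Q βR n := by
        rcases hc.eq_or_eq with rfl | rfl
        · exact le_add_of_nonneg_right (abs_nonneg _)
        · exact le_add_of_nonneg_left (abs_nonneg _)
      exact (le_abs_self _).trans (h2.trans (h1.trans (by linarith)))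
  · obtain ⟨n₀, hn₀⟩ := DESinc.exists_forall_le_rate hd hg hdec
    refine ⟨n₀, fun M N n β hc hn => ?_⟩
    rw [one_mul]
    exact hn₀ M N n β hc hn
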